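/- Let $K$ be a non-Archimedean local field with ring of integers $O=\{|x|\le 1\}$, maximal ideal $P=\{|x|<1\}=\beta O$, $q=\#(O/P)$, normalized absolute value ($|\beta|=q^{-1}$), and Haar measure $dx$ with $\int_O dx=1$. Let $\alpha>0$. For a radial function $v=v(|x|)$, $v:K\to\mathbb C$, put $$ (I^\alpha v)(x)=\frac{1-q^{-\alpha}}{1-q^{\alpha-1}}\int_{|y|\le|x|}\left(|x-y|^{\alpha-1}-|y|^{\alpha-1}\right)v(|y|)\,dy\quad(\alpha\ne1), $$ $$ (I^1 v)(x)=\frac{1-q}{q\log q}\int_{|y|\le|x|}\left(\log|x-y|-\log|y|\right)v(|y|)\,dy . $$ For a radial function $u$, $D^\alpha u$ is said to be defined in the strong sense if, for some $m\in\mathbb Z$, $\sum_{k\le m}q^k|u(q^k)|<\infty$ and $\sum_{l\ge m}q^{-\alpha l}|u(q^l)|<\infty$, so that $$ (D^\alpha u)(x)=\frac{1-q^\alpha}{1-q^{-\alpha-1}}\int_K|y|^{-\alpha-1}\left[u(|x-y|)-u(|x|)\right]dy\qquad(x\ne0) $$ exists, and if the limit $(D^\alpha u)(0):=\lim_{x\to0}(D^\alpha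 u)(x)$ exists. **Theorem 2.** Let $a,f:K\to\mathbb C$ be continuous radial functions with $a(|x|)\ne-q^{\alpha m}$ for all $x\in K$, $m\in\mathbb Z$. Assume that, for some $C,\varepsilon>0$, $|a(|x|)|\le C|x|^{-\alpha-\varepsilon}$ and $|f(|x|)|\le C|x|^{-\varepsilon}$ for all $|x|>1$. Then the integral equation $$ v(|x|)+a(|x|)\,(I^\alpha v)(|x|)=f(|x|),\qquad x\in K, $$ has a unique continuous radial solution $v$ on $K$, and $u=I^\alpha v$ is a strong solution of the Cauchy problem $$ D^\alpha u+a(|x|)u=f(|x|),\qquad u(0)=0, $$ that is, $u$ is continuous and radial, $u(0)=0$, $D^\alpha u$ is defined in the strong sense, and the equation holds at every $x\in K$ (including $x=0$). -/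

import Mathlib

open MeasureTheory Filter Topology

namespace RadialFrac

/-- The ring of integers `O = {x : |x| ≤ 1}` of an ultrametric normed field. -/
noncomputable abbrev integers (K : Type*) [NontriviallyNormedField K] [IsUltrametricDist K] :
    ValuationSubring K :=
  (NormedField.valuation (K := K)).valuationSubring

/-- `q`, the cardinality of the residue field `O / P`. -/
noncomputable def residueCard (K : Type*) [NontriviallyNormedField K] [IsUltrametricDist K] : ℕ :=
  Nat.card (IsLocalRing.ResidueField (integers K))

/-- `β` generates the maximal ideal `P = {x : |x| < 1}`, that is `P = β O`, and the absolute value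
is normalized, that is `|β| = q⁻¹`. -/
structure IsNormalizedUniformizer {K : Type*} [NontriviallyNormedField K] [IsUltrametricDist K]
    (β : K) : Prop where
  norm_eq : ‖β‖ = (residueCard K : ℝ)⁻¹
  generates : ∀ x : K, ‖x‖ < 1 ↔ ∃ y : K, ‖y‖ ≤ 1 ∧ x = β * y

/-- A function on `K` is radial if it depends on the absolute value only: `u = u(|x|)`.
The value `u(q ^ n)` of such a function is then `u (β ^ (-n))`. -/
def IsRadial {K : Type*} [NontriviallyNormedField K] (u : K → ℂ) : Prop :=
  ∀ x y : K, ‖x‖ = ‖y‖ → u x = u y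

section Operators

variable {K : Type*} [NontriviallyNormedField K] [IsUltrametricDist K]

/-- The integrand `|y| ^ (-α - 1) (u(x - y) - u(x))` of the hypersingular integral. -/
noncomputable def hypersingularIntegrand (α : ℝ) (u : K → ℂ) (x y : K) : ℂ :=
  ((‖y‖ ^ (-α - 1) : ℝ) : ℂ) * (u (x - y) - u x)

/-- The hypersingular integral
`(1 - q ^ α) / (1 - q ^ (-α - 1)) * ∫ |y| ^ (-α - 1) (u(x - y) - u(x)) dy`. -/
noncomputable def hypersingularIntegral [MeasurableSpace K] (μ : Measure K) (α : ℝ) (u : K → ℂ)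
    (x : K) : ℂ :=
  (((1 - (residueCard K : ℝ) ^ α) / (1 - (residueCard K : ℝ) ^ (-α - 1)) : ℝ) : ℂ) *
    ∫ y, hypersingularIntegrand α u x y ∂μ

/-- The kernel of the fractional integral: `|x - y| ^ (α - 1) - |y| ^ (α - 1)` for `α ≠ 1` and
`log |x - y| - log |y|` for `α = 1`. -/
noncomputable def fracIntKernel (α : ℝ) (x y : K) : ℝ :=
  if α = 1 then Real.log ‖x - y‖ - Real.log ‖y‖ else ‖x - y‖ ^ (α - 1) - ‖y‖ ^ (α - 1)

/-- The constant in front of the fractional integral. -/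
noncomputable def fracIntConst (K : Type*) [NontriviallyNormedField K] [IsUltrametricDist K]
    (α : ℝ) : ℝ :=
  if α = 1 then
    (1 - (residueCard K : ℝ)) / ((residueCard K : ℝ) * Real.log (residueCard K : ℝ))
  else
    (1 - (residueCard K : ℝ) ^ (-α)) / (1 - (residueCard K : ℝ) ^ (α - 1))

/-- The integral defining `(I^α v)(x)` converges absolutely. -/
def FracIntExistsAt [MeasurableSpace K] (μ : Measure K) (α : ℝ) (v : K → ℂ) (x : K) : Prop :=
  IntegrableOn (fun y => (fracIntKernel α x y : ℂ) * v y) {y : K | ‖y‖ ≤ ‖x‖} μ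

/-- The fractional integral `I^α v`. -/
noncomputable def fracInt [MeasurableSpace K] (μ : Measure K) (α : ℝ) (v : K → ℂ) (x : K) : ℂ :=
  (fracIntConst K α : ℂ) * ∫ y in {y : K | ‖y‖ ≤ ‖x‖}, (fracIntKernel α x y : ℂ) * v y ∂μ

/-- The action `D^α u` on the radial function `u` is defined in the strong sense and is equal
to `g`: for some `m` the series of `q ^ k |u(q ^ k)|` over `k ≤ m` and of `q ^ (-α l) |u(q ^ l)|`
over `l ≥ m` converge; for `x ≠ 0` the value `g x` is the (absolutely convergent) hypersingular
integral; and `g 0` is the limit of `g x` as `x → 0`, `x ≠ 0`. -/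
structure HasStrongFracDeriv [MeasurableSpace K] (μ : Measure K) (β : K) (α : ℝ)
    (u g : K → ℂ) : Prop where
  radial : IsRadial u
  summable : ∃ m : ℤ,
    Summable (fun k : Set.Iic m => (residueCard K : ℝ) ^ (k : ℤ) * ‖u (β ^ (-(k : ℤ)))‖) ∧
    Summable (fun l : Set.Ici m =>
      (residueCard K : ℝ) ^ (-α * ((l : ℤ) : ℝ)) * ‖u (β ^ (-(l : ℤ)))‖)
  integrable : ∀ x : K, x ≠ 0 → Integrable (hypersingularIntegrand α u x) μ
  eq_integral : ∀ x : K, x ≠ 0 → g x = hypersingularIntegral μ α u x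
  tendsto_zero : Tendsto g (𝓝[≠] 0) (𝓝 (g 0))

/-- `u` is a strong radial solution of the Cauchy problem `D^α u + a(|x|) u = f(|x|)`, `u(0) = 0`:
a continuous radial function with `u(0) = 0` for which `D^α u` is defined in the strong sense, the
equation being satisfied at every point of `K`, including `0`. -/
structure IsStrongRadialSolution [MeasurableSpace K] (μ : Measure K) (β : K) (α : ℝ)
    (a f u : K → ℂ) : Prop where
  radial : IsRadial u
  continuous : Continuous u
  equation : ∃ g : K → ℂ, HasStrongFracDeriv μ β α u g ∧ ∀ x : K, g x + a x * u x = f x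
  initial : u 0 = 0

/-- `v` is a continuous radial solution on all of `K` of the integral equation
`v(|x|) + a(|x|) (I^α v)(|x|) = f(|x|)`. -/
structure IsIntegralEqSolution [MeasurableSpace K] (μ : Measure K) (α : ℝ)
    (a f v : K → ℂ) : Prop where
  radial : IsRadial v
  continuous : Continuous v
  fracIntExists : ∀ x : K, FracIntExistsAt μ α v x
  equation : ∀ x : K, v x + a x * fracInt μ α v x = f x

end Operators

end RadialFrac

/-! A radial function is a sequence v_n = v(q^n), n ∈ ℤ, together with its value at 0, and it is
continuous exactly when v_n → v(0) as n → -∞. Everything thus reduces to two-sided sequences. Put p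
= q⁻¹, s = q^(-α), let k_i be the coefficients of 1 / ((1 - sz)(1 - pz)) and R = k * v. Summing over
spheres gives (I^α v)(q^n) = s^(-n) U_n with U_n = s (v_n - (1-s)(1-p) R_{n-1}) (`fracInt_eq`). For
α = 1 the double root s = p accounts for the logarithmic kernel, so the later arguments need no case
distinction.

Since v_n = R_n - (s+p) R_{n-1} + sp R_{n-2}, also U_n = s (Δ_n - sp Δ_{n-1}) with Δ_n = R_n -
R_{n-1}. The sums of U that arise in the hypersingular integral of I^α v therefore telescope, and
D^α I^α v = v as soon as R is summable at +∞ (`hypersingularIntegral_eq`).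

The integral equation becomes v_n = d_n + c_n R_{n-1}; the values excluded for a keep the
coefficient of v_n from vanishing. Here c_n → 0 at both ends and d is bounded, so a contraction in a
weighted sup norm yields exactly one bounded solution (`existsUnique_bounded_volterra`). A
continuous solution is a priori bounded only to the left, but the decay of the data makes its R
summable at +∞ (`summable_causalSum_of_volterra`) and hence the solution bounded. This gives
uniqueness among all continuous solutions. The same summability gives D^α u = v for u = I^α v, which
turns the integral equation into the Cauchy problem. -/

namespace RadialFrac

/-! ### Convolution identities for two-sided sequences. -/

section Sequences

/-- The power series coefficients of `1 / ((1 - s z) (1 - p z))`. -/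
def convCoeff (s p : ℝ) : ℕ → ℝ
  | 0 => 1
  | i + 1 => p ^ (i + 1) + s * convCoeff s p i

/-- The convolution of a two-sided sequence with `convCoeff s p`. -/
noncomputable def causalSum (s p : ℝ) (v : ℤ → ℂ) (n : ℤ) : ℂ :=
  ∑' i : ℕ, (convCoeff s p i : ℂ) * v (n - i)

/-- A two-sided sequence which is bounded on every left half-line. -/
def BddLeft (v : ℤ → ℂ) : Prop := ∀ N : ℤ, ∃ B : ℝ, ∀ n ≤ N, ‖v n‖ ≤ B

lemma bddLeft_of_eventually {v : ℤ → ℂ} {B : ℝ} (h : ∀ᶠ n in atBot, ‖v n‖ ≤ B) : BddLeft v := by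
  intro N
  obtain ⟨N₀, hN₀⟩ := eventually_atBot.1 h
  obtain ⟨B', hB'⟩ := ((Set.finite_Icc N₀ N).image fun n => ‖v n‖).bddAbove
  refine ⟨max B B', fun n hn => ?_⟩
  rcases le_total n N₀ with h1 | h1
  · exact (hN₀ n h1).trans (le_max_left _ _)
  · exact (hB' ⟨n, ⟨h1, hn⟩, rfl⟩).trans (le_max_right _ _)

lemma bddLeft_of_tendsto {v : ℤ → ℂ} {l : ℂ} (h : Tendsto v atBot (𝓝 l)) : BddLeft v :=
  bddLeft_of_eventually (B := ‖l‖ + 1) (h.norm.eventually (eventually_le_nhds (by linarith)))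

variable {s p : ℝ}

lemma convCoeff_nonneg (hs : 0 < s) (hp : 0 < p) (i : ℕ) : 0 ≤ convCoeff s p i := by
  induction i with
  | zero => simp [convCoeff]
  | succ i ih => simp only [convCoeff]; positivity

/-- This form matches the power kernel (α ≠ 1, where s ≠ p); the double-root form below matches the
logarithmic kernel. -/
lemma convCoeff_closed (i : ℕ) : (s - p) * convCoeff s p i = s ^ (i + 1) - p ^ (i + 1) := by
  induction i with
  | zero => simp [convCoeff]
  | succ i ih =>
    simp only [convCoeff]
    linear_combination s * ih

lemma convCoeff_self (i : ℕ) : convCoeff p p i = (i + 1) * p ^ i := by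
  induction i with
  | zero => simp [convCoeff]
  | succ i ih =>
    simp only [convCoeff, ih]
    push_cast
    ring

/-- A ratio r strictly above both roots absorbs the linear factor of the double root s = p. The
constant r / (r - s) solves r + s M = M r, which closes the induction. -/
lemma convCoeff_le_geometric (hs : 0 < s) (hs1 : s < 1) (hp : 0 < p) (hp1 : p < 1) :
    ∃ M r : ℝ, 0 ≤ M ∧ 0 < r ∧ r < 1 ∧ ∀ i, convCoeff s p i ≤ M * r ^ i := by
  obtain ⟨r, hr, hr1⟩ := exists_between (max_lt hs1 hp1)
  have hsr : s < r := (le_max_left _ _).trans_lt hr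
  have hpr : p < r := (le_max_right _ _).trans_lt hr
  have hr0 : 0 < r := hs.trans hsr
  have hd : 0 < r - s := sub_pos.2 hsr
  have hM : 0 ≤ r / (r - s) := by positivity
  refine ⟨r / (r - s), r, hM, hr0, hr1, fun i => ?_⟩
  induction i with
  | zero =>
    simp only [convCoeff, pow_zero, mul_one]
    rw [le_div_iff₀ hd]; linarith
  | succ i ih =>
    simp only [convCoeff]
    have h1 : p ^ (i + 1) ≤ r ^ (i + 1) := pow_le_pow_left₀ hp.le hpr.le _
    have h2 : s * convCoeff s p i ≤ s * (r / (r - s) * r ^ i) := by gcongr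
    have h3 : r ^ (i + 1) + s * (r / (r - s) * r ^ i) = r / (r - s) * r ^ (i + 1) := by
      field_simp; ring
    linarith

lemma summable_convCoeff (hs : 0 < s) (hs1 : s < 1) (hp : 0 < p) (hp1 : p < 1) :
    Summable (convCoeff s p) := by
  obtain ⟨M, r, -, hr, hr1, h⟩ := convCoeff_le_geometric hs hs1 hp hp1
  exact Summable.of_nonneg_of_le (convCoeff_nonneg hs hp) h
    ((summable_geometric_of_lt_one hr.le hr1).mul_left M)

lemma summable_norm_causal {k : ℕ → ℝ} (hk : Summable k) (hk0 : ∀ i, 0 ≤ k i) {v : ℤ → ℂ}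
    {n : ℤ} {B : ℝ} (hB : ∀ m ≤ n, ‖v m‖ ≤ B) :
    Summable fun i : ℕ => ‖(k i : ℂ) * v (n - i)‖ := by
  refine Summable.of_nonneg_of_le (fun _ => norm_nonneg _) (fun i => ?_) (hk.mul_right B)
  rw [norm_mul, Complex.norm_real, Real.norm_of_nonneg (hk0 i)]
  exact mul_le_mul_of_nonneg_left (hB _ (by omega)) (hk0 i)

lemma norm_causalSum_le (hs : 0 < s) (hs1 : s < 1) (hp : 0 < p) (hp1 : p < 1) {v : ℤ → ℂ}
    {n : ℤ} {B : ℝ} (hB : ∀ m ≤ n, ‖v m‖ ≤ B) :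
    ‖causalSum s p v n‖ ≤ (∑' i, convCoeff s p i) * B := by
  rw [← tsum_mul_right]
  refine tsum_of_norm_bounded ((summable_convCoeff hs hs1 hp hp1).mul_right B).hasSum fun i => ?_
  rw [norm_mul, Complex.norm_real, Real.norm_of_nonneg (convCoeff_nonneg hs hp i)]
  exact mul_le_mul_of_nonneg_left (hB _ (by omega)) (convCoeff_nonneg hs hp i)

lemma causalSum_summable (hs : 0 < s) (hs1 : s < 1) (hp : 0 < p) (hp1 : p < 1) {v : ℤ → ℂ}
    (hv : BddLeft v) (n : ℤ) : Summable fun i : ℕ => (convCoeff s p i : ℂ) * v (n - i) :=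
  let ⟨_, hB⟩ := hv n
  (summable_norm_causal (summable_convCoeff hs hs1 hp hp1) (convCoeff_nonneg hs hp) hB).of_norm

lemma bddLeft_causalSum (hs : 0 < s) (hs1 : s < 1) (hp : 0 < p) (hp1 : p < 1) {v : ℤ → ℂ}
    (hv : BddLeft v) : BddLeft (causalSum s p v) := fun N =>
  let ⟨_, hB⟩ := hv N
  ⟨_, fun _ hn => norm_causalSum_le hs hs1 hp hp1 fun m hm => hB m (hm.trans hn)⟩

lemma causalSum_sub (hs : 0 < s) (hs1 : s < 1) (hp : 0 < p) (hp1 : p < 1) {v w : ℤ → ℂ}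
    (hv : BddLeft v) (hw : BddLeft w) (n : ℤ) :
    causalSum s p (fun m => v m - w m) n = causalSum s p v n - causalSum s p w n := by
  unfold causalSum
  rw [← (causalSum_summable hs hs1 hp hp1 hv n).tsum_sub (causalSum_summable hs hs1 hp hp1 hw n)]
  exact tsum_congr fun i => by ring

/-- Convolution with the geometric sequence. -/
noncomputable def geomSum (p : ℝ) (v : ℤ → ℂ) (n : ℤ) : ℂ := ∑' i : ℕ, ((p ^ i : ℝ) : ℂ) * v (n - i)

lemma geomSum_eq (hp : 0 < p) (hp1 : p < 1) {v : ℤ → ℂ} (hv : BddLeft v) (n : ℤ) :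
    geomSum p v n = v n + p * geomSum p v (n - 1) := by
  obtain ⟨B, hB⟩ := hv n
  have hS := (summable_norm_causal (summable_geometric_of_lt_one hp.le hp1)
    (fun i => by positivity) hB).of_norm
  unfold geomSum
  rw [hS.tsum_eq_zero_add, ← tsum_mul_left]
  congr 1
  · simp
  · refine tsum_congr fun i => ?_
    rw [show n - ((i + 1 : ℕ) : ℤ) = n - 1 - i by push_cast; ring]
    push_cast; ring

lemma causalSum_eq (hs : 0 < s) (hs1 : s < 1) (hp : 0 < p) (hp1 : p < 1) {v : ℤ → ℂ}
    (hv : BddLeft v) (n : ℤ) :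
    causalSum s p v n = geomSum p v n + s * causalSum s p v (n - 1) := by
  obtain ⟨B, hB⟩ := hv n
  have hS := (summable_norm_causal (summable_geometric_of_lt_one hp.le hp1)
    (fun i => by positivity) hB).of_norm
  have hS' := (summable_nat_add_iff 1).2 hS
  have hR := causalSum_summable hs hs1 hp hp1 hv n
  have hR' := causalSum_summable hs hs1 hp hp1 hv (n - 1)
  unfold geomSum causalSum
  rw [hS.tsum_eq_zero_add, hR.tsum_eq_zero_add, ← tsum_mul_left, add_assoc,
    ← hS'.tsum_add (hR'.mul_left _)]
  congr 1
  refine tsum_congr fun i => ?_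
  rw [show n - ((i + 1 : ℕ) : ℤ) = n - 1 - i by push_cast; ring, convCoeff]
  push_cast; ring

/-- With T the backward shift, R = (1 - sT)⁻¹ (1 - pT)⁻¹ v; the two first-order relations above undo
one factor each. -/
lemma causalSum_recurrence (hs : 0 < s) (hs1 : s < 1) (hp : 0 < p) (hp1 : p < 1) {v : ℤ → ℂ}
    (hv : BddLeft v) (n : ℤ) :
    v n = causalSum s p v n - (s + p) * causalSum s p v (n - 1)
      + s * p * causalSum s p v (n - 2) := by
  have h1 := causalSum_eq hs hs1 hp hp1 hv n
  have h2 := causalSum_eq hs hs1 hp hp1 hv (n - 1)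
  have h3 := geomSum_eq hp hp1 hv n
  rw [show n - 1 - 1 = n - 2 by ring] at h2
  linear_combination (-1 : ℂ) * h1 + p * h2 - h3

/-- The sequence `|x| ^ (-α) (I^α v)(x)`, `|x| = q ^ n`, in terms of the values of `v`, where
`p = q⁻¹` and `s = q ^ (-α)`. -/
noncomputable def fracSeq (s p : ℝ) (v : ℤ → ℂ) (n : ℤ) : ℂ :=
  s * (v n - (1 - s) * (1 - p) * causalSum s p v (n - 1))

/-- In terms of R, the operator factors as s (1 - T)(1 - spT), with T the backward shift. The factor
1 - T makes plain sums to the right telescope, and 1 - spT makes (sp)^i-weighted sums to the left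
telescope. -/
lemma fracSeq_eq_sub (hs : 0 < s) (hs1 : s < 1) (hp : 0 < p) (hp1 : p < 1) {v : ℤ → ℂ}
    (hv : BddLeft v) (n : ℤ) :
    fracSeq s p v n = s * ((causalSum s p v n - causalSum s p v (n - 1))
      - s * p * (causalSum s p v (n - 1) - causalSum s p v (n - 2))) := by
  rw [fracSeq]
  linear_combination (s : ℂ) * causalSum_recurrence hs hs1 hp hp1 hv n

lemma bddLeft_fracSeq (hs : 0 < s) (hs1 : s < 1) (hp : 0 < p) (hp1 : p < 1) {v : ℤ → ℂ}
    (hv : BddLeft v) : BddLeft (fracSeq s p v) := by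
  intro N
  obtain ⟨B, hB⟩ := hv N
  obtain ⟨B', hB'⟩ := bddLeft_causalSum hs hs1 hp hp1 hv N
  refine ⟨‖(s : ℂ)‖ * (B + ‖((1 - s) * (1 - p) : ℂ)‖ * B'), fun n hn => ?_⟩
  rw [fracSeq, norm_mul]
  gcongr
  refine (norm_sub_le _ _).trans ?_
  rw [norm_mul]
  gcongr
  · exact hB n hn
  · exact hB' _ (by omega)

lemma summable_int_shift {z : ℤ → ℝ} {N : ℤ} (h : Summable fun j : ℕ => z (N + j)) (m : ℤ) :
    Summable fun j : ℕ => z (m + j) := by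
  rcases le_total N m with hNm | hNm
  · obtain ⟨k, rfl⟩ := Int.le.dest hNm
    refine ((summable_nat_add_iff k).2 h).congr fun j => ?_
    congr 1; push_cast; ring
  · obtain ⟨k, rfl⟩ := Int.le.dest hNm
    refine (summable_nat_add_iff k).1 (h.congr fun j => ?_)
    congr 1; push_cast; ring

lemma summable_fracSeq (hs : 0 < s) (hs1 : s < 1) (hp : 0 < p) (hp1 : p < 1) {v : ℤ → ℂ}
    (hv : BddLeft v) {N : ℤ} (hR : Summable fun j : ℕ => ‖causalSum s p v (N + j)‖) (m : ℤ) :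
    Summable fun j : ℕ => ‖fracSeq s p v (m + j)‖ := by
  have hsh := fun m => summable_int_shift (z := fun n => ‖causalSum s p v n‖) hR m
  have h := (((hsh m).add (hsh (m - 1))).add
    (((hsh (m - 1)).add (hsh (m - 2))).mul_left ‖(s * p : ℂ)‖)).mul_left ‖(s : ℂ)‖
  refine Summable.of_nonneg_of_le (fun _ => norm_nonneg _) (fun j => ?_) h
  rw [fracSeq_eq_sub hs hs1 hp hp1 hv, norm_mul, show m + (j : ℤ) - 1 = m - 1 + j by ring,
    show m + (j : ℤ) - 2 = m - 2 + j by ring]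
  gcongr
  refine (norm_sub_le _ _).trans ?_
  rw [norm_mul]
  gcongr <;> exact norm_sub_le _ _

/-- Telescoping; the boundary term at +∞ vanishes because R is summable there. -/
lemma hasSum_fracSeq_right (hs : 0 < s) (hs1 : s < 1) (hp : 0 < p) (hp1 : p < 1) {v : ℤ → ℂ}
    (hv : BddLeft v) {N : ℤ} (hR : Summable fun j : ℕ => ‖causalSum s p v (N + j)‖) (n : ℤ) :
    HasSum (fun i : ℕ => fracSeq s p v (n + 1 + i))
      (-(s * (causalSum s p v n - s * p * causalSum s p v (n - 1)))) := by
  rw [(summable_fracSeq hs hs1 hp hp1 hv hR (n + 1)).of_norm.hasSum_iff_tendsto_nat]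
  set Y : ℕ → ℂ := fun i =>
    s * (causalSum s p v (n + i) - s * p * causalSum s p v (n - 1 + i)) with hY
  have hsum : ∀ k : ℕ, ∑ i ∈ Finset.range k, fracSeq s p v (n + 1 + i) = Y k - Y 0 := by
    intro k
    rw [← Finset.sum_range_sub]
    refine Finset.sum_congr rfl fun i _ => ?_
    rw [fracSeq_eq_sub hs hs1 hp hp1 hv, hY]
    simp only [Nat.cast_add, Nat.cast_one]
    rw [show n + 1 + (i : ℤ) - 1 = n + i by ring, show n + 1 + (i : ℤ) - 2 = n - 1 + i by ring,
      show n + ((i : ℤ) + 1) = n + 1 + i by ring, show n - 1 + ((i : ℤ) + 1) = n + i by ring]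
    ring
  have hlim : ∀ m : ℤ, Tendsto (fun i : ℕ => causalSum s p v (m + i)) atTop (𝓝 0) := fun m =>
    (summable_int_shift (z := fun n => ‖causalSum s p v n‖) hR m).of_norm.tendsto_atTop_zero
  have hYlim : Tendsto Y atTop (𝓝 (s * (0 - s * p * 0))) :=
    ((hlim n).sub ((hlim (n - 1)).const_mul _)).const_mul _
  refine ((hYlim.sub_const (Y 0)).congr fun k => (hsum k).symm).trans_eq ?_
  simp [hY]

/-- Telescoping; at -∞ the weight (sp)^i kills the boundary term, R being bounded there. -/
lemma hasSum_fracSeq_left (hs : 0 < s) (hs1 : s < 1) (hp : 0 < p) (hp1 : p < 1) {v : ℤ → ℂ}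
    (hv : BddLeft v) (n : ℤ) :
    HasSum (fun i : ℕ => (((s * p) ^ (i + 1) : ℝ) : ℂ) * fracSeq s p v (n - 1 - i))
      (s * (s * p * (causalSum s p v (n - 1) - causalSum s p v (n - 2)))) := by
  have hsp0 : 0 < s * p := by positivity
  have hsp1 : s * p < 1 := mul_lt_one_of_nonneg_of_lt_one_left hs.le hs1 hp1.le
  have hg := summable_geometric_of_lt_one hsp0.le hsp1
  have hS : Summable fun i : ℕ => (((s * p) ^ (i + 1) : ℝ) : ℂ) * fracSeq s p v (n - 1 - i) := by
    obtain ⟨B, hB⟩ := bddLeft_fracSeq hs hs1 hp hp1 hv (n - 1)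
    exact (summable_norm_causal ((summable_nat_add_iff 1).2 hg) (fun i => by positivity) hB).of_norm
  rw [hS.hasSum_iff_tendsto_nat]
  set Y : ℕ → ℂ := fun i => (((s * p) ^ (i + 1) : ℝ) : ℂ) *
    (s * (causalSum s p v (n - 1 - i) - causalSum s p v (n - 2 - i))) with hY
  have hsum : ∀ k : ℕ, ∑ i ∈ Finset.range k,
      (((s * p) ^ (i + 1) : ℝ) : ℂ) * fracSeq s p v (n - 1 - i) = Y 0 - Y k := by
    intro k
    rw [← Finset.sum_range_sub']
    refine Finset.sum_congr rfl fun i _ => ?_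
    rw [fracSeq_eq_sub hs hs1 hp hp1 hv, hY]
    simp only [Nat.cast_add, Nat.cast_one]
    rw [show n - 1 - (i : ℤ) - 1 = n - 2 - i by ring,
      show n - 1 - (i : ℤ) - 2 = n - 3 - i by ring,
      show n - 1 - ((i : ℤ) + 1) = n - 2 - i by ring,
      show n - 2 - ((i : ℤ) + 1) = n - 3 - i by ring]
    push_cast; ring
  have hYlim : Tendsto Y atTop (𝓝 0) := by
    obtain ⟨B, hB⟩ := bddLeft_causalSum hs hs1 hp hp1 hv (n - 1)
    refine squeeze_zero_norm (fun i => ?_)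
      (((((summable_nat_add_iff 1).2 hg).tendsto_atTop_zero).mul_const (s * (B + B))).trans_eq
        (by simp))
    rw [hY, norm_mul, Complex.norm_real, Real.norm_of_nonneg (by positivity), norm_mul,
      Complex.norm_real, Real.norm_of_nonneg hs.le]
    gcongr
    exact (norm_sub_le _ _).trans (add_le_add (hB _ (by omega)) (hB _ (by omega)))
  refine ((hYlim.const_sub (Y 0)).congr fun k => (hsum k).symm).trans_eq ?_
  simp only [hY]; congr 1; push_cast; simp; ring

end Sequences

/-! ### The discrete Volterra equation: unique bounded solution and decay. -/

section Solvability

variable {s p : ℝ}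

/-- A sequence of positive weights which turns a small-at-infinity coefficient into a uniformly
small one. -/
lemma exists_weight {c : ℤ → ℝ} (hc : Tendsto c cofinite (𝓝 0)) :
    ∃ (ρ : ℤ → ℝ) (A : ℝ), Monotone ρ ∧ (∀ n, 0 < ρ n) ∧ (∀ n, ρ n ≤ A) ∧ (∀ n, A⁻¹ ≤ ρ n) ∧
      ∀ n, c n * ρ (n - 1) ≤ ρ n / 2 := by
  have hfin : {n | ¬ c n < 1 / 2}.Finite :=
    hc.eventually (gt_mem_nhds (by norm_num : (0 : ℝ) < 1 / 2))
  obtain ⟨M, hM⟩ : ∃ M : ℕ, ∀ n : ℤ, ¬ c n < 1 / 2 → n.natAbs ≤ M := by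
    obtain ⟨M, hM⟩ := (hfin.image Int.natAbs).bddAbove
    exact ⟨M, fun n hn => hM ⟨n, hn, rfl⟩⟩
  obtain ⟨B, hB⟩ : ∃ B : ℝ, ∀ n : ℤ, ¬ c n < 1 / 2 → c n ≤ B := by
    obtain ⟨B, hB⟩ := (hfin.image c).bddAbove
    exact ⟨B, fun n hn => hB ⟨n, hn, rfl⟩⟩
  -- The weight grows by the factor `lam` per step across the finite window where `c` is not small,
  -- and is constant outside it.
  set lam : ℝ := max 1 (2 * B) with hlam
  have h1 : 1 ≤ lam := le_max_left _ _
  have h0 : 0 < lam := one_pos.trans_le h1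
  -- Clamping at M + 1 rather than M ensures a genuine increase from n - 1 to n even at n = -M.
  set cl : ℤ → ℤ := fun n => max (-(M + 1 : ℤ)) (min n (M + 1)) with hcl
  have hmono : Monotone fun n => lam ^ cl n := fun m n hmn =>
    zpow_le_zpow_right₀ h1 (by simp only [hcl]; omega)
  refine ⟨fun n => lam ^ cl n, lam ^ (M + 1 : ℤ), hmono, fun n => by positivity,
    fun n => zpow_le_zpow_right₀ h1 (by simp only [hcl]; omega), fun n => ?_, fun n => ?_⟩
  · rw [← zpow_neg]
    exact zpow_le_zpow_right₀ h1 (by simp only [hcl]; omega)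
  · by_cases hn : c n < 1 / 2
    · have := hmono (show n - 1 ≤ n by omega)
      have h2 : 0 < lam ^ cl (n - 1) := by positivity
      simp only at this ⊢
      nlinarith
    · have hnM := hM n hn
      have hs : cl n = cl (n - 1) + 1 := by simp only [hcl]; omega
      simp only
      rw [hs, zpow_add_one₀ h0.ne']
      have h2 : 0 < lam ^ cl (n - 1) := by positivity
      have h3 : 2 * c n ≤ lam := (mul_le_mul_of_nonneg_left (hB n hn) (by norm_num)).trans
        (le_max_right _ _)
      nlinarith

/-- The Volterra equation `v n = d n + c n * causalSum s p v (n - 1)` has exactly one bounded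
solution if `c` vanishes at infinity and `d` is bounded. -/
lemma existsUnique_bounded_volterra (hs : 0 < s) (hs1 : s < 1) (hp : 0 < p) (hp1 : p < 1)
    {c d : ℤ → ℂ} (hc : Tendsto c cofinite (𝓝 0)) (hd : ∃ D, ∀ n, ‖d n‖ ≤ D) :
    ∃! v : ℤ → ℂ, (∃ B, ∀ n, ‖v n‖ ≤ B) ∧ ∀ n, v n = d n + c n * causalSum s p v (n - 1) := by
  obtain ⟨D, hD⟩ := hd
  set H : ℝ := ∑' i, convCoeff s p i with hH
  have hH0 : 0 ≤ H := tsum_nonneg (convCoeff_nonneg hs hp)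
  obtain ⟨ρ, A, hmono, hpos, hA, hA', hρ⟩ := exists_weight (c := fun n => ‖c n‖ * H)
    ((hc.norm.mul_const H).trans_eq (by simp))
  have hA0 : 0 < A := (hpos 0).trans_le (hA 0)
  have hbl : ∀ g : BoundedContinuousFunction ℤ ℂ, BddLeft fun n => ρ n * g n := fun g N =>
    ⟨A * ‖g‖, fun n _ => by
      rw [norm_mul, Complex.norm_real, Real.norm_of_nonneg (hpos n).le]
      exact mul_le_mul (hA n) (g.norm_coe_le_norm n) (norm_nonneg _) hA0.le⟩
  -- The sum only looks at m ≤ n - 1, where the monotone weight is at most `ρ (n - 1)`; the choice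
  -- of `ρ` then yields the factor 1/2.
  have hest : ∀ (g : BoundedContinuousFunction ℤ ℂ) (n : ℤ),
      ‖c n * causalSum s p (fun m => ρ m * g m) (n - 1) / ρ n‖ ≤ 1 / 2 * ‖g‖ := by
    intro g n
    rw [norm_div, norm_mul, Complex.norm_real, Real.norm_of_nonneg (hpos n).le,
      div_le_iff₀ (hpos n)]
    have h1 : ‖causalSum s p (fun m => ρ m * g m) (n - 1)‖ ≤ H * (ρ (n - 1) * ‖g‖) :=
      norm_causalSum_le hs hs1 hp hp1 fun m hm => by
        rw [norm_mul, Complex.norm_real, Real.norm_of_nonneg (hpos m).le]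
        exact mul_le_mul (hmono hm) (g.norm_coe_le_norm m) (norm_nonneg _) (hpos _).le
    calc ‖c n‖ * ‖causalSum s p (fun m => ρ m * g m) (n - 1)‖
        ≤ ‖c n‖ * (H * (ρ (n - 1) * ‖g‖)) := by gcongr
      _ = (‖c n‖ * H * ρ (n - 1)) * ‖g‖ := by ring
      _ ≤ (ρ n / 2) * ‖g‖ := by gcongr; exact hρ n
      _ = 1 / 2 * ‖g‖ * ρ n := by ring
  have hbdd : ∀ (g : BoundedContinuousFunction ℤ ℂ) (n : ℤ),
      ‖(d n + c n * causalSum s p (fun m => ρ m * g m) (n - 1)) / ρ n‖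
        ≤ D * A + 1 / 2 * ‖g‖ := by
    intro g n
    rw [add_div]
    refine (norm_add_le _ _).trans (add_le_add ?_ (hest g n))
    rw [norm_div, Complex.norm_real, Real.norm_of_nonneg (hpos n).le, div_eq_mul_inv]
    refine mul_le_mul (hD n) ?_ (by have := hpos n; positivity) ((norm_nonneg _).trans (hD n))
    exact inv_le_of_inv_le₀ hA0 (hA' n)
  let Φ : BoundedContinuousFunction ℤ ℂ → BoundedContinuousFunction ℤ ℂ := fun g =>
    BoundedContinuousFunction.ofNormedAddCommGroup
      (fun n => (d n + c n * causalSum s p (fun m => ρ m * g m) (n - 1)) / ρ n)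
      continuous_of_discreteTopology _ (hbdd g)
  have hΦ : ∀ g n, Φ g n = (d n + c n * causalSum s p (fun m => ρ m * g m) (n - 1)) / ρ n :=
    fun _ _ => rfl
  have hcontr : ContractingWith (1 / 2) Φ := by
    refine ⟨by norm_num, LipschitzWith.of_dist_le_mul fun g g' => ?_⟩
    rw [BoundedContinuousFunction.dist_le (by positivity)]
    intro n
    have h := hest (g - g') n
    rw [dist_eq_norm, dist_eq_norm, hΦ, hΦ]
    have h2 : causalSum s p (fun m => ρ m * (g - g') m) (n - 1)
        = causalSum s p (fun m => ρ m * g m) (n - 1)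
          - causalSum s p (fun m => ρ m * g' m) (n - 1) := by
      rw [← causalSum_sub hs hs1 hp hp1 (hbl g) (hbl g')]
      congr 1; funext m; simp [mul_sub]
    rw [h2] at h
    refine (le_of_eq ?_).trans (h.trans_eq (by simp))
    congr 1; ring
  have hρC : ∀ n, (ρ n : ℂ) ≠ 0 := fun n => Complex.ofReal_ne_zero.2 (hpos n).ne'
  have hfix := hcontr.fixedPoint_isFixedPt
  set g₀ := ContractingWith.fixedPoint Φ hcontr with hg₀
  refine ⟨fun n => ρ n * g₀ n, ⟨⟨A * ‖g₀‖, fun n => ?_⟩, fun n => ?_⟩, ?_⟩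
  · rw [norm_mul, Complex.norm_real, Real.norm_of_nonneg (hpos n).le]
    exact mul_le_mul (hA n) (g₀.norm_coe_le_norm n) (norm_nonneg _) hA0.le
  · have h := hΦ g₀ n
    rw [hfix.eq] at h
    simp only
    conv_lhs => rw [h]
    exact mul_div_cancel₀ _ (hρC n)
  · rintro w ⟨⟨B, hB⟩, hw⟩
    -- The weight lies between `A⁻¹` and `A`, so weighted and unweighted boundedness agree and
    -- uniqueness covers every bounded solution.
    have hgb : ∀ n, ‖w n / ρ n‖ ≤ B * A := fun n => by
      rw [norm_div, Complex.norm_real, Real.norm_of_nonneg (hpos n).le, div_eq_mul_inv]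
      exact mul_le_mul (hB n) (inv_le_of_inv_le₀ hA0 (hA' n)) (by have := hpos n; positivity)
        ((norm_nonneg _).trans (hB n))
    let g : BoundedContinuousFunction ℤ ℂ := BoundedContinuousFunction.ofNormedAddCommGroup
      (fun n => w n / ρ n) continuous_of_discreteTopology _ hgb
    have hg : ∀ n, (ρ n : ℂ) * g n = w n := fun n => mul_div_cancel₀ _ (hρC n)
    have hgfix : Function.IsFixedPt Φ g := by
      ext n
      rw [hΦ]
      simp only [hg]
      rw [← hw n]
      rfl
    funext n
    rw [← hg n, hcontr.fixedPoint_unique hgfix]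

lemma le_geometric_of_recurrence {Z : ℕ → ℝ} {r τ A : ℝ} (hr0 : 0 ≤ r) (hr : r < 1) (hτ0 : 0 ≤ τ)
    (hτ : τ < 1) (hA : 0 ≤ A) (hZ : ∀ j, Z (j + 1) ≤ r * Z j + A * τ ^ j) :
    ∃ M σ : ℝ, 0 < σ ∧ σ < 1 ∧ ∀ j, Z j ≤ M * σ ^ j := by
  obtain ⟨σ, hσ, hσ1⟩ := exists_between (max_lt hr hτ)
  have hrσ : r < σ := (le_max_left _ _).trans_lt hσ
  have hτσ : τ < σ := (le_max_right _ _).trans_lt hσ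
  have hσ0 : 0 < σ := hr0.trans_lt hrσ
  refine ⟨max (Z 0) (A / (σ - r)), σ, hσ0, hσ1, fun j => ?_⟩
  set M := max (Z 0) (A / (σ - r)) with hM
  induction j with
  | zero => simp [hM]
  | succ j ih =>
    have h1 : A * τ ^ j ≤ A * σ ^ j := by gcongr
    have h2 : A ≤ M * (σ - r) := (div_le_iff₀ (sub_pos.2 hrσ)).1 (le_max_right _ _)
    calc Z (j + 1) ≤ r * Z j + A * τ ^ j := hZ j
      _ ≤ r * (M * σ ^ j) + A * σ ^ j := by gcongr
      _ = (r * M + A) * σ ^ j := by ring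
      _ ≤ (M * σ) * σ ^ j := by gcongr; linarith
      _ = M * σ ^ (j + 1) := by ring

/-- A solution of the Volterra equation with decaying data decays. -/
lemma summable_causalSum_of_volterra (hs : 0 < s) (hs1 : s < 1) (hp : 0 < p) (hp1 : p < 1)
    {c d v : ℤ → ℂ} (hv : BddLeft v) (hc : Tendsto c atTop (𝓝 0)) {D τ : ℝ} (hD : 0 ≤ D)
    (hτ0 : 0 ≤ τ) (hτ : τ < 1) (hd : ∀ᶠ j : ℕ in atTop, ‖d j‖ ≤ D * τ ^ j)
    (h : ∀ n, v n = d n + c n * causalSum s p v (n - 1)) :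
    ∃ N : ℤ, Summable fun j : ℕ => ‖causalSum s p v (N + j)‖ := by
  -- The quantity ‖P‖ + l ‖R‖ serves as a Lyapunov function for the first-order system of P =
  -- `geomSum` and R. The weight l is small enough that P still contracts, and δ is chosen so that
  -- (1 + l) δ + l s = l (1 + s) / 2, which makes R contract once |c| ≤ δ.
  obtain ⟨l, hl, hpl⟩ : ∃ l : ℝ, 0 < l ∧ (1 + l) * p < 1 :=
    ⟨(1 - p) / 2, by linarith, by nlinarith⟩
  set δ : ℝ := l * ((1 - s) / 2) / (1 + l) with hδ
  have hδ0 : 0 < δ := by have : 0 < 1 - s := sub_pos.2 hs1; positivity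
  obtain ⟨N₁, hN₁⟩ := eventually_atTop.1 (hc.norm.eventually (eventually_le_nhds (by simpa using hδ0)))
  obtain ⟨N₂, hN₂⟩ := eventually_atTop.1 hd
  set N : ℕ := max N₁.toNat N₂ with hN
  set P : ℤ → ℂ := geomSum p v with hP
  set R : ℤ → ℂ := causalSum s p v with hR
  set r : ℝ := max ((1 + l) * p) ((1 + s) / 2) with hr
  have hr0 : 0 ≤ r := le_max_of_le_right (by linarith)
  have hr1 : r < 1 := max_lt hpl (by linarith)
  have key : ∀ j : ℕ, (‖P (N + (j + 1 : ℕ))‖ + l * ‖R (N + (j + 1 : ℕ))‖)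
      ≤ r * (‖P (N + j)‖ + l * ‖R (N + j)‖) + ((1 + l) * (D * τ ^ (N + 1))) * τ ^ j := by
    intro j
    have e1 : ((N : ℤ) + (j + 1 : ℕ)) - 1 = N + j := by push_cast; ring
    have hp' := geomSum_eq hp hp1 hv (N + (j + 1 : ℕ))
    have hr' := causalSum_eq hs hs1 hp hp1 hv (N + (j + 1 : ℕ))
    have hv' := h (N + (j + 1 : ℕ))
    rw [e1] at hp' hr' hv'
    have b1 : ‖d (N + (j + 1 : ℕ))‖ ≤ D * τ ^ (N + 1) * τ ^ j := by
      have := hN₂ (N + (j + 1)) (by omega)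
      rw [mul_assoc, ← pow_add, add_assoc, add_comm 1 j]
      exact_mod_cast this
    have b2 : ‖c (N + (j + 1 : ℕ))‖ ≤ δ := hN₁ _ (by omega)
    have b3 : ‖v (N + (j + 1 : ℕ))‖ ≤ D * τ ^ (N + 1) * τ ^ j + δ * ‖R (N + j)‖ := by
      rw [hv']
      refine (norm_add_le _ _).trans (add_le_add b1 ?_)
      rw [norm_mul]; gcongr
    have b4 : ‖P (N + (j + 1 : ℕ))‖ ≤ ‖v (N + (j + 1 : ℕ))‖ + p * ‖P (N + j)‖ := by
      rw [hP, hp']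
      refine (norm_add_le _ _).trans (add_le_add le_rfl ?_)
      rw [norm_mul, Complex.norm_real, Real.norm_of_nonneg hp.le]
    have b5 : ‖R (N + (j + 1 : ℕ))‖ ≤ ‖P (N + (j + 1 : ℕ))‖ + s * ‖R (N + j)‖ := by
      rw [hR, hr']
      refine (norm_add_le _ _).trans (add_le_add le_rfl ?_)
      rw [norm_mul, Complex.norm_real, Real.norm_of_nonneg hs.le]
    have hd1 : (1 + l) * δ + l * s = l * ((1 + s) / 2) := by rw [hδ]; field_simp; ring
    have q1 : (1 + l) * p * ‖P (N + j)‖ ≤ r * ‖P (N + j)‖ := by gcongr; exact le_max_left _ _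
    have q2 : (1 + s) / 2 * (l * ‖R (N + j)‖) ≤ r * (l * ‖R (N + j)‖) := by
      gcongr; exact le_max_right _ _
    calc ‖P (N + (j + 1 : ℕ))‖ + l * ‖R (N + (j + 1 : ℕ))‖
        ≤ (1 + l) * ‖P (N + (j + 1 : ℕ))‖ + l * s * ‖R (N + j)‖ := by nlinarith
      _ ≤ (1 + l) * (D * τ ^ (N + 1) * τ ^ j + δ * ‖R (N + j)‖ + p * ‖P (N + j)‖)
          + l * s * ‖R (N + j)‖ := by gcongr; linarith
      _ = (1 + l) * p * ‖P (N + j)‖ + ((1 + l) * δ + l * s) * ‖R (N + j)‖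
          + (1 + l) * (D * τ ^ (N + 1)) * τ ^ j := by ring
      _ ≤ _ := by rw [hd1]; linarith
  obtain ⟨M, σ, hσ0, hσ1, hM⟩ := le_geometric_of_recurrence (Z := fun j : ℕ =>
    ‖P (N + j)‖ + l * ‖R (N + j)‖) hr0 hr1 hτ0 hτ (by positivity) key
  refine ⟨N, Summable.of_nonneg_of_le (fun _ => norm_nonneg _) (fun j => ?_)
    ((summable_geometric_of_lt_one hσ0.le hσ1).mul_left (M / l))⟩
  have h1 := hM j
  have h2 := norm_nonneg (P (N + j))
  rw [div_mul_eq_mul_div, le_div_iff₀ hl]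
  linarith

end Solvability

/-! ### Value group, Haar measure of balls and spheres, radial integration. -/

section LocalField

lemma measure_closedBall_ne_top {K : Type*} [NontriviallyNormedField K] [LocallyCompactSpace K]
    [MeasurableSpace K] {μ : Measure K} [μ.IsAddHaarMeasure] (r : ℝ) :
    μ (Metric.closedBall (0 : K) r) ≠ ⊤ :=
  have : ProperSpace K := ProperSpace.of_locallyCompactSpace K
  (isCompact_closedBall (0 : K) r).measure_ne_top

variable {K : Type*} [NontriviallyNormedField K] [IsUltrametricDist K] {β : K}

lemma mem_integers_iff (x : K) : x ∈ integers K ↔ ‖x‖ ≤ 1 := by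
  rw [Valuation.mem_valuationSubring_iff, NormedField.valuation_apply, ← NNReal.coe_le_coe]
  simp

lemma integers_isUnit_iff (x : integers K) : IsUnit x ↔ ‖(x : K)‖ = 1 := by
  have hx : ‖(x : K)‖ ≤ 1 := (mem_integers_iff _).1 x.2
  constructor
  · rintro ⟨u, rfl⟩
    have h1 : ((u : integers K) : K) * ((u⁻¹ : (integers K)ˣ) : integers K) = 1 := by
      exact_mod_cast congrArg Subtype.val u.mul_inv
    have h2 : ‖(((u⁻¹ : (integers K)ˣ) : integers K) : K)‖ ≤ 1 :=
      (mem_integers_iff _).1 (Subtype.prop _)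
    have h3 := congrArg norm h1
    rw [norm_mul, norm_one] at h3
    nlinarith [norm_nonneg ((u : integers K) : K)]
  · intro h
    have hx0 : (x : K) ≠ 0 := norm_ne_zero_iff.1 (by rw [h]; exact one_ne_zero)
    have hm : (x : K)⁻¹ ∈ integers K := (mem_integers_iff _).2 (by rw [norm_inv, h, inv_one])
    exact IsUnit.of_mul_eq_one ⟨_, hm⟩ (Subtype.ext (mul_inv_cancel₀ hx0))

lemma residue_eq_iff (x y : integers K) :
    IsLocalRing.residue _ x = IsLocalRing.residue _ y ↔ ‖(x : K) - y‖ < 1 := by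
  have h : ‖((x - y : integers K) : K)‖ ≤ 1 := (mem_integers_iff _).1 (x - y).2
  rw [← sub_eq_zero, ← map_sub, IsLocalRing.residue_eq_zero_iff, IsLocalRing.mem_maximalIdeal,
    mem_nonunits_iff, integers_isUnit_iff]
  exact ⟨fun h' => lt_of_le_of_ne h h', fun h' => h'.ne⟩

namespace IsNormalizedUniformizer

lemma ne_zero (hβ : IsNormalizedUniformizer β) : β ≠ 0 := by
  rintro rfl
  obtain ⟨x, hx0, hx1⟩ := NormedField.exists_norm_lt_one K
  obtain ⟨y, -, rfl⟩ := (hβ.generates x).1 hx1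
  simp at hx0

lemma one_lt_residueCard (hβ : IsNormalizedUniformizer β) : 1 < residueCard K := by
  -- An infinite residue field would have `Nat.card` equal to 0, and the normalization would force β
  -- = 0.
  have h0 : residueCard K ≠ 0 := fun h => by
    have h1 := hβ.norm_eq
    rw [h, Nat.cast_zero, inv_zero, norm_eq_zero] at h1
    exact hβ.ne_zero h1
  have : Finite (IsLocalRing.ResidueField (integers K)) := Nat.finite_of_card_ne_zero h0
  exact Finite.one_lt_card

lemma one_lt_cast (hβ : IsNormalizedUniformizer β) : (1 : ℝ) < residueCard K := by
  exact_mod_cast hβ.one_lt_residueCard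

lemma cast_pos (hβ : IsNormalizedUniformizer β) : (0 : ℝ) < residueCard K :=
  one_pos.trans hβ.one_lt_cast

lemma norm_zpow_neg (hβ : IsNormalizedUniformizer β) (n : ℤ) :
    ‖β ^ (-n)‖ = (residueCard K : ℝ) ^ n := by
  rw [norm_zpow, hβ.norm_eq, inv_zpow, zpow_neg, inv_inv]

lemma norm_lt_one_iff (hβ : IsNormalizedUniformizer β) (x : K) :
    ‖x‖ < 1 ↔ ‖x‖ ≤ (residueCard K : ℝ)⁻¹ := by
  constructor
  · intro h
    obtain ⟨y, hy, rfl⟩ := (hβ.generates x).1 h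
    rw [norm_mul, hβ.norm_eq]
    exact mul_le_of_le_one_right (by positivity) hy
  · intro h
    exact h.trans_lt (inv_lt_one_of_one_lt₀ hβ.one_lt_cast)

lemma norm_lt_zpow_iff (hβ : IsNormalizedUniformizer β) (x : K) (n : ℤ) :
    ‖x‖ < (residueCard K : ℝ) ^ n ↔ ‖x‖ ≤ (residueCard K : ℝ) ^ (n - 1) := by
  have hQ := zpow_pos hβ.cast_pos n
  have h := hβ.norm_lt_one_iff (x / β ^ (-n))
  rw [norm_div, hβ.norm_zpow_neg, div_lt_one hQ, div_le_iff₀ hQ, ← zpow_neg_one,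
    ← zpow_add₀ hβ.cast_pos.ne'] at h
  rwa [show n - 1 = -1 + n by ring]

lemma exists_norm_eq (hβ : IsNormalizedUniformizer β) {x : K} (hx : x ≠ 0) :
    ∃ n : ℤ, ‖x‖ = (residueCard K : ℝ) ^ n := by
  obtain ⟨n, h1, h2⟩ := exists_mem_Ioc_zpow (norm_pos_iff.2 hx) hβ.one_lt_cast
  refine ⟨n + 1, le_antisymm h2 (le_of_not_gt fun h => ?_)⟩
  rw [hβ.norm_lt_zpow_iff, add_sub_cancel_right] at h
  exact absurd h1 (not_lt.2 h)

/-- After scaling by a power of β this is the partition of O into cosets of P; translation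
invariance then makes the volume of balls scale by q. -/
lemma closedBall_eq_iUnion (hβ : IsNormalizedUniformizer β) (n : ℤ) :
    ∃ c : IsLocalRing.ResidueField (integers K) → K,
      Metric.closedBall (0 : K) ((residueCard K : ℝ) ^ n)
        = ⋃ r, Metric.closedBall (c r) ((residueCard K : ℝ) ^ (n - 1)) ∧
      Pairwise (Function.onFun Disjoint
        fun r => Metric.closedBall (c r) ((residueCard K : ℝ) ^ (n - 1))) := by
  choose rep hrep using IsLocalRing.residue_surjective (R := integers K)
  have hQ := zpow_pos hβ.cast_pos n
  have hb : β ^ (-n) ≠ 0 := zpow_ne_zero _ hβ.ne_zero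
  have hmem : ∀ (x : K) r, x ∈ Metric.closedBall (β ^ (-n) * (rep r : K))
      ((residueCard K : ℝ) ^ (n - 1)) ↔ ‖x / β ^ (-n) - rep r‖ < 1 := by
    intro x r
    rw [mem_closedBall_iff_norm, ← hβ.norm_lt_zpow_iff, ← div_lt_one hQ, ← hβ.norm_zpow_neg,
      ← norm_div, sub_div, mul_div_cancel_left₀ _ hb]
  have hle : ∀ x : K, ‖x‖ ≤ (residueCard K : ℝ) ^ n ↔ ‖x / β ^ (-n)‖ ≤ 1 := fun x => by
    rw [norm_div, hβ.norm_zpow_neg, div_le_one hQ]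
  refine ⟨fun r => β ^ (-n) * (rep r : K), ?_, ?_⟩
  · ext x
    rw [mem_closedBall_zero_iff, hle, Set.mem_iUnion]
    simp only [hmem]
    constructor
    · intro h
      refine ⟨IsLocalRing.residue _ ⟨_, (mem_integers_iff _).2 h⟩, ?_⟩
      rw [← residue_eq_iff ⟨_, (mem_integers_iff _).2 h⟩, hrep]
    · rintro ⟨r, hr⟩
      have := IsUltrametricDist.norm_add_le_max (x / β ^ (-n) - rep r) (rep r)
      rw [sub_add_cancel] at this
      exact this.trans (max_le hr.le ((mem_integers_iff _).1 (rep r).2))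
  · intro r r' hrr'
    rw [Function.onFun, Set.disjoint_left]
    intro x hx hx'
    rw [hmem] at hx hx'
    refine hrr' ?_
    rw [← hrep r, ← hrep r', residue_eq_iff]
    have := IsUltrametricDist.norm_add_le_max (x / β ^ (-n) - rep r') (-(x / β ^ (-n) - rep r))
    rw [norm_neg, ← sub_eq_add_neg, sub_sub_sub_cancel_left] at this
    exact this.trans_lt (max_lt hx' hx)

variable [MeasurableSpace K] [BorelSpace K] {μ : Measure K}

lemma measure_closedBall_succ [μ.IsAddHaarMeasure] (hβ : IsNormalizedUniformizer β) (n : ℤ) :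
    μ (Metric.closedBall (0 : K) ((residueCard K : ℝ) ^ n))
      = residueCard K * μ (Metric.closedBall (0 : K) ((residueCard K : ℝ) ^ (n - 1))) := by
  obtain ⟨c, h1, h2⟩ := hβ.closedBall_eq_iUnion n
  have : Finite (IsLocalRing.ResidueField (integers K)) := Nat.finite_of_card_ne_zero
    (by have := hβ.one_lt_residueCard; unfold residueCard at this; omega)
  have := Fintype.ofFinite (IsLocalRing.ResidueField (integers K))
  have hb : ∀ r, μ (Metric.closedBall (c r) ((residueCard K : ℝ) ^ (n - 1)))
      = μ (Metric.closedBall (0 : K) ((residueCard K : ℝ) ^ (n - 1))) := fun r => by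
    rw [← measure_preimage_add μ (c r) (Metric.closedBall (c r) _)]
    congr 1
    ext y
    simp
  rw [h1, measure_iUnion h2 fun r => Metric.isClosed_closedBall.measurableSet, tsum_congr hb,
    tsum_fintype, Finset.sum_const, Finset.card_univ, nsmul_eq_mul, residueCard,
    Nat.card_eq_fintype_card]

lemma measureReal_closedBall [μ.IsAddHaarMeasure] (hβ : IsNormalizedUniformizer β)
    (hμ : μ (Metric.closedBall (0 : K) 1) = 1) (n : ℤ) :
    μ.real (Metric.closedBall (0 : K) ((residueCard K : ℝ) ^ n)) = (residueCard K : ℝ) ^ n := by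
  have hs : ∀ n : ℤ, μ.real (Metric.closedBall (0 : K) ((residueCard K : ℝ) ^ n))
      = residueCard K * μ.real (Metric.closedBall (0 : K) ((residueCard K : ℝ) ^ (n - 1))) := by
    intro n
    rw [Measure.real, hβ.measure_closedBall_succ, ENNReal.toReal_mul, ENNReal.toReal_natCast,
      Measure.real]
  have hQ := hβ.cast_pos.ne'
  induction n using Int.induction_on with
  | zero => simp [Measure.real, hμ]
  | succ i ih => rw [hs, add_sub_cancel_right, ih, mul_comm, zpow_add_one₀ hQ]
  | pred i ih =>
    refine mul_left_cancel₀ hQ ?_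
    rw [← hs, ih, zpow_sub_one₀ hQ, mul_left_comm, mul_inv_cancel₀ hQ, mul_one]

end IsNormalizedUniformizer

/-- The sphere `{x : |x| = q ^ n}`. -/
def sphere (K : Type*) [NontriviallyNormedField K] [IsUltrametricDist K] (n : ℤ) : Set K :=
  {y : K | ‖y‖ = (residueCard K : ℝ) ^ n}

lemma measure_sphere_ne_top {K : Type*} [NontriviallyNormedField K] [IsUltrametricDist K]
    [LocallyCompactSpace K] [MeasurableSpace K] {μ : Measure K} [μ.IsAddHaarMeasure] (n : ℤ) : μ (sphere K n) ≠ ⊤ :=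
  ne_top_of_le_ne_top (measure_closedBall_ne_top ((residueCard K : ℝ) ^ n))
    (measure_mono fun _ hy => mem_closedBall_zero_iff.2 (le_of_eq hy))

variable [MeasurableSpace K] [BorelSpace K] {μ : Measure K}

lemma measurableSet_sphere (n : ℤ) : MeasurableSet (sphere K n) :=
  measurableSet_eq_fun continuous_norm.measurable measurable_const

variable [LocallyCompactSpace K]

lemma measureReal_sphere [μ.IsAddHaarMeasure] (hβ : IsNormalizedUniformizer β)
    (hμ : μ (Metric.closedBall (0 : K) 1) = 1) (n : ℤ) :
    μ.real (sphere K n) = (residueCard K : ℝ) ^ n * (1 - (residueCard K : ℝ)⁻¹) := by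
  have h : sphere K n = Metric.closedBall (0 : K) ((residueCard K : ℝ) ^ n)
      \ Metric.closedBall (0 : K) ((residueCard K : ℝ) ^ (n - 1)) := by
    ext y
    simp only [sphere, Set.mem_ofPred_eq, Set.mem_sdiff, mem_closedBall_zero_iff,
      ← hβ.norm_lt_zpow_iff, not_lt]
    exact le_antisymm_iff
  rw [h, measureReal_sdiff
    (Metric.closedBall_subset_closedBall (zpow_le_zpow_right₀ hβ.one_lt_cast.le (by omega)))
    Metric.isClosed_closedBall.measurableSet
    (measure_closedBall_ne_top _), hβ.measureReal_closedBall hμ,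
    hβ.measureReal_closedBall hμ, zpow_sub_one₀ hβ.cast_pos.ne']
  ring

/-- Integration of radial functions over a countable union of spheres. -/
lemma IsRadial.integral_iUnion_sphere [μ.IsAddHaarMeasure] (hβ : IsNormalizedUniformizer β)
    (hμ : μ (Metric.closedBall (0 : K) 1) = 1) {G : K → ℂ} (hG : IsRadial G) {e : ℕ → ℤ}
    (he : Function.Injective e) {T : ℕ → ℂ}
    (hT : ∀ i, (residueCard K : ℂ) ^ e i * G (β ^ (-e i)) = T i) (hS : Summable fun i => ‖T i‖) :
    IntegrableOn G (⋃ i, sphere K (e i)) μ ∧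
      ∫ y in ⋃ i, sphere K (e i), G y ∂μ = (1 - (residueCard K : ℂ)⁻¹) * ∑' i, T i := by
  have hc : ∀ n, ∀ y ∈ sphere K n, G y = G (β ^ (-n)) := fun n y hy =>
    hG _ _ (by rw [hβ.norm_zpow_neg]; exact hy)
  have hint : ∀ i, IntegrableOn G (sphere K (e i)) μ := fun i =>
    (integrableOn_const (measure_sphere_ne_top _)).congr_fun (fun y hy => (hc _ y hy).symm)
      (measurableSet_sphere _)
  have h1 : ∀ i, ∫ y in sphere K (e i), ‖G y‖ ∂μ
      = (1 - (residueCard K : ℝ)⁻¹) * ‖T i‖ := fun i => by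
    rw [setIntegral_congr_fun (measurableSet_sphere _) fun y hy => by rw [hc _ y hy],
      setIntegral_const, measureReal_sphere hβ hμ, smul_eq_mul, ← hT, norm_mul, norm_zpow,
      Complex.norm_natCast]
    ring
  have h2 : ∀ i, ∫ y in sphere K (e i), G y ∂μ = (1 - (residueCard K : ℂ)⁻¹) * T i := fun i => by
    rw [setIntegral_congr_fun (measurableSet_sphere _) (hc (e i)),
      setIntegral_const, measureReal_sphere hβ hμ, Complex.real_smul, ← hT]
    push_cast; ring
  have hI : IntegrableOn G (⋃ i, sphere K (e i)) μ :=
    integrableOn_iUnion_of_summable_integral_norm hint ((hS.mul_left _).congr fun i => (h1 i).symm)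
  refine ⟨hI, ?_⟩
  rw [← tsum_mul_left, ← tsum_congr h2]
  refine integral_iUnion (fun i => measurableSet_sphere _) (fun i j hij => ?_) hI
  rw [Function.onFun, Set.disjoint_left]
  intro y hy hy'
  exact hij (he (zpow_right_injective₀ hβ.cast_pos hβ.one_lt_cast.ne' (hy.symm.trans hy')))

lemma IsRadial.integral_norm_gt [μ.IsAddHaarMeasure] (hβ : IsNormalizedUniformizer β)
    (hμ : μ (Metric.closedBall (0 : K) 1) = 1) {G : K → ℂ} (hG : IsRadial G) {n : ℤ} {T : ℕ → ℂ}
    (hT : ∀ i : ℕ, (residueCard K : ℂ) ^ (n + 1 + i) * G (β ^ (-(n + 1 + i))) = T i)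
    (hS : Summable fun i => ‖T i‖) :
    IntegrableOn G {y | (residueCard K : ℝ) ^ n < ‖y‖} μ ∧
      ∫ y in {y | (residueCard K : ℝ) ^ n < ‖y‖}, G y ∂μ
        = (1 - (residueCard K : ℂ)⁻¹) * ∑' i, T i := by
  have h : {y : K | (residueCard K : ℝ) ^ n < ‖y‖} = ⋃ i : ℕ, sphere K (n + 1 + i) := by
    ext y
    simp only [Set.mem_ofPred_eq, Set.mem_iUnion, sphere]
    constructor
    · intro hy
      obtain ⟨m, hm⟩ := hβ.exists_norm_eq
        (norm_pos_iff.1 ((zpow_pos hβ.cast_pos n).trans hy))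
      rw [hm, zpow_lt_zpow_iff_right₀ hβ.one_lt_cast] at hy
      exact ⟨(m - n - 1).toNat, by rw [hm]; congr 1; omega⟩
    · rintro ⟨i, hi⟩
      rw [hi, zpow_lt_zpow_iff_right₀ hβ.one_lt_cast]
      omega
  rw [h]
  exact hG.integral_iUnion_sphere hβ hμ (fun i j hij => by simpa using hij) hT hS

lemma IsRadial.integral_norm_lt [μ.IsAddHaarMeasure] (hβ : IsNormalizedUniformizer β)
    (hμ : μ (Metric.closedBall (0 : K) 1) = 1) {G : K → ℂ} (hG : IsRadial G) {n : ℤ} {T : ℕ → ℂ}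
    (hT : ∀ i : ℕ, (residueCard K : ℂ) ^ (n - 1 - i) * G (β ^ (-(n - 1 - i))) = T i)
    (hS : Summable fun i => ‖T i‖) :
    IntegrableOn G {y | ‖y‖ < (residueCard K : ℝ) ^ n} μ ∧
      ∫ y in {y | ‖y‖ < (residueCard K : ℝ) ^ n}, G y ∂μ
        = (1 - (residueCard K : ℂ)⁻¹) * ∑' i, T i := by
  have h : {y : K | ‖y‖ < (residueCard K : ℝ) ^ n} =ᵐ[μ] ⋃ i : ℕ, sphere K (n - 1 - i) := by
    -- The spheres miss only the origin, which is a null set.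
    have h0 : ∀ᵐ y ∂μ, y ≠ (0 : K) := by
      rw [ae_iff]
      simp
    filter_upwards [h0] with y hy0
    refine propext ?_
    change ‖y‖ < (residueCard K : ℝ) ^ n ↔ y ∈ ⋃ i : ℕ, sphere K (n - 1 - i)
    simp only [Set.mem_ofPred_eq, Set.mem_iUnion, sphere]
    constructor
    · intro hy
      obtain ⟨m, hm⟩ := hβ.exists_norm_eq hy0
      rw [hm, zpow_lt_zpow_iff_right₀ hβ.one_lt_cast] at hy
      exact ⟨(n - 1 - m).toNat, by rw [hm]; congr 1; omega⟩
    · rintro ⟨i, hi⟩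
      rw [hi, zpow_lt_zpow_iff_right₀ hβ.one_lt_cast]
      omega
  rw [setIntegral_congr_set h]
  have := hG.integral_iUnion_sphere hβ hμ (e := fun i : ℕ => n - 1 - i)
    (fun i j hij => by simpa using hij) hT hS
  exact ⟨this.1.congr_set_ae h, this.2⟩

end LocalField

/-! ### The fractional integral as a convolution. -/

section FractionalIntegral

lemma zpow_rpow_comm {Q : ℝ} (hQ : 0 < Q) (n : ℤ) (y : ℝ) : (Q ^ n) ^ y = (Q ^ y) ^ n := by
  rw [← Real.rpow_intCast, ← Real.rpow_mul hQ.le, mul_comm, Real.rpow_mul hQ.le, Real.rpow_intCast]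

/-- The generating function at z = 1, obtained from the recurrence for v = 1. -/
lemma tsum_convCoeff {s p : ℝ} (hs : 0 < s) (hs1 : s < 1) (hp : 0 < p) (hp1 : p < 1) :
    (1 - s : ℂ) * (1 - p) * ∑' i, (convCoeff s p i : ℂ) = 1 := by
  have hv : BddLeft fun _ => (1 : ℂ) := fun N => ⟨1, fun n _ => by simp⟩
  have h := causalSum_recurrence hs hs1 hp hp1 hv 0
  simp only [causalSum, mul_one] at h
  linear_combination -h

/-- The function of `|x|` whose differences form the kernel of the fractional integral. -/
noncomputable def kernelFun (α r : ℝ) : ℝ := if α = 1 then Real.log r else r ^ (α - 1)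

lemma fracIntKernel_eq {K : Type*} [NontriviallyNormedField K] (α : ℝ) (x y : K) :
    fracIntKernel α x y = kernelFun α ‖x - y‖ - kernelFun α ‖y‖ := by
  unfold fracIntKernel kernelFun
  split_ifs <;> rfl

lemma measurableSet_norm_lt {K : Type*} [NontriviallyNormedField K] [MeasurableSpace K]
    [BorelSpace K] (r : ℝ) : MeasurableSet {y : K | ‖y‖ < r} :=
  measurableSet_lt continuous_norm.measurable measurable_const

variable {K : Type*} [NontriviallyNormedField K] [IsUltrametricDist K] {β : K}

/-- This is where the kernel becomes k_i: a difference of logarithms gives the factor i + 1 when s =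
p, and a difference of powers gives s^(i+1) - p^(i+1) otherwise. -/
lemma fracIntConst_mul_kernelFun (hβ : IsNormalizedUniformizer β) {α : ℝ}
    {s p : ℝ} (hs : s = (residueCard K : ℝ) ^ (-α)) (hp : p = (residueCard K : ℝ)⁻¹)
    (n : ℤ) (i : ℕ) :
    fracIntConst K α * ((residueCard K : ℝ) ^ (n - 1 - i) *
      (kernelFun α ((residueCard K : ℝ) ^ n) - kernelFun α ((residueCard K : ℝ) ^ (n - 1 - i))))
      = -(s * (1 - s) * s ^ (-n) * convCoeff s p i) := by
  have hQ := hβ.cast_pos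
  have hQ1 := hβ.one_lt_cast
  set Q : ℝ := (residueCard K : ℝ) with hQdef
  have hp0 : 0 < p := by rw [hp]; positivity
  have hs0 : 0 < s := by rw [hs]; positivity
  unfold fracIntConst kernelFun
  rw [← hQdef]
  by_cases h1 : α = 1
  · have hsp : s = p := by rw [hs, hp, h1, Real.rpow_neg_one]
    have hlog : Real.log Q ≠ 0 := (Real.log_pos hQ1).ne'
    simp only [if_pos h1]
    rw [hsp, convCoeff_self, Real.log_zpow, Real.log_zpow]
    have e1 : Q ^ (n - 1 - i) = p ^ (-n) * p * p ^ i := by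
      rw [show Q = p⁻¹ by rw [hp, inv_inv], inv_zpow', ← zpow_natCast, ← zpow_add_one₀ hp0.ne',
        ← zpow_add₀ hp0.ne']
      congr 1; ring
    have e2 : p * Q = 1 := by rw [hp]; exact inv_mul_cancel₀ hQ.ne'
    rw [e1]
    push_cast
    rw [div_mul_eq_mul_div, div_eq_iff (by positivity)]
    linear_combination (-(p ^ (-n) * p ^ i * p * (i + 1) * Real.log Q)) * e2
  · simp only [if_neg h1]
    rw [zpow_rpow_comm hQ, zpow_rpow_comm hQ]
    have e0 : Q ^ (α - 1) = p / s := by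
      rw [hs, hp, Real.rpow_sub hQ, Real.rpow_one, Real.rpow_neg hQ.le]
      field_simp
    have e3 : 1 - p / s ≠ 0 := by
      rw [← e0, sub_ne_zero]
      intro h
      rcases lt_or_gt_of_ne h1 with h2 | h2
      · exact (Real.rpow_lt_one_of_one_lt_of_neg hQ1 (by linarith)).ne h.symm
      · exact (Real.one_lt_rpow hQ1 (by linarith)).ne h
    have hsp : s - p ≠ 0 := by
      intro h
      exact e3 (by rw [← sub_eq_zero.1 h, div_self hs0.ne', sub_self])
    have e1 : Q ^ (n - 1 - i) = p ^ (-n) * p * p ^ i := by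
      rw [show Q = p⁻¹ by rw [hp, inv_inv], inv_zpow', ← zpow_natCast, ← zpow_add_one₀ hp0.ne',
        ← zpow_add₀ hp0.ne']
      congr 1; ring
    have e4 : (p / s) ^ (n - 1 - (i : ℤ)) = (p / s) ^ n * (s / p) * (s / p) ^ i := by
      rw [sub_sub, zpow_sub₀ (by positivity), zpow_one_add₀ (by positivity), zpow_natCast,
        div_eq_mul_inv, mul_inv, inv_div, ← inv_pow, inv_div, mul_assoc]
    have hcl := convCoeff_closed (s := s) (p := p) i
    rw [e0, e1, e4, ← hs, div_zpow, zpow_neg, zpow_neg, div_pow]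
    have hsn : s ^ n ≠ 0 := zpow_ne_zero _ hs0.ne'
    have hpn : p ^ n ≠ 0 := zpow_ne_zero _ hp0.ne'
    have hpi : p ^ i ≠ 0 := pow_ne_zero _ hp0.ne'
    have e5 : 1 - p / s = (s - p) / s := by field_simp
    rw [e5]
    rw [pow_succ, pow_succ] at hcl
    field_simp
    linear_combination (1 - s) * hcl

/-- The values of a radial function along the value group. -/
def radialSeq (β : K) (v : K → ℂ) (n : ℤ) : ℂ := v (β ^ (-n))

lemma IsRadial.eq_radialSeq (hβ : IsNormalizedUniformizer β) {v : K → ℂ} (hv : IsRadial v) {x : K}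
    {n : ℤ} (hx : ‖x‖ = (residueCard K : ℝ) ^ n) : v x = radialSeq β v n :=
  hv _ _ (by rw [hx, hβ.norm_zpow_neg])

lemma norm_sub_eq_of_lt {x y : K} (h : ‖y‖ < ‖x‖) : ‖x - y‖ = ‖x‖ := by
  rw [sub_eq_add_neg, IsUltrametricDist.norm_add_eq_max_of_norm_ne_norm (by simpa using h.ne'),
    norm_neg, max_eq_left h.le]

variable [MeasurableSpace K] [BorelSpace K] {μ : Measure K} [LocallyCompactSpace K]

/-- A function which splits into a radial-type part and the reflection of another one about `x`. -/
lemma integral_indicator_add_reflect [μ.IsAddHaarMeasure] {A B : Set K} (hA : MeasurableSet A)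
    (hB : MeasurableSet B) {g h F : K → ℂ} {x : K} (hg : IntegrableOn g A μ)
    (hh : IntegrableOn h B μ)
    (hF : ∀ y, F y = A.indicator g y + B.indicator h (x - y)) :
    Integrable F μ ∧ ∫ y, F y ∂μ = ∫ y in A, g y ∂μ + ∫ y in B, h y ∂μ := by
  have : ProperSpace K := ProperSpace.of_locallyCompactSpace K
  have : μ.IsNegInvariant := Measure.IsAddHaarMeasure.isNegInvariant_of_regular μ
  have e : F = fun y => A.indicator g y + B.indicator h (x - y) := funext hF
  have i1 : Integrable (A.indicator g) μ := hg.integrable_indicator hA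
  have i2 : Integrable (fun y => B.indicator h (x - y)) μ :=
    (hh.integrable_indicator hB).comp_sub_left x
  rw [e]
  refine ⟨i1.add i2, ?_⟩
  rw [integral_add i1 i2, integral_sub_left_eq_self, integral_indicator hA, integral_indicator hB]

/-- For |y| < |x| one has |x - y| = |x|, so the kernel is radial in y and produces the convolution.
On |y| = |x| the factor v is the constant v(x), and z = x - y turns the integral into the opposite
kernel over |z| < |x|; its total mass gives the coefficient of v_n. -/
lemma fracInt_eq [μ.IsAddHaarMeasure] (hβ : IsNormalizedUniformizer β)
    (hμ : μ (Metric.closedBall (0 : K) 1) = 1) {α : ℝ} (hα : 0 < α) {s p : ℝ}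
    (hs : s = (residueCard K : ℝ) ^ (-α)) (hp : p = (residueCard K : ℝ)⁻¹) {v : K → ℂ}
    (hv : IsRadial v) (hb : BddLeft (radialSeq β v)) {x : K} {n : ℤ}
    (hx : ‖x‖ = (residueCard K : ℝ) ^ n) :
    FracIntExistsAt μ α v x ∧
      fracInt μ α v x = (s : ℂ) ^ (-n) * fracSeq s p (radialSeq β v) n := by
  have hQ := hβ.cast_pos
  have hQ1 := hβ.one_lt_cast
  have hs0 : 0 < s := by rw [hs]; positivity
  have hs1 : s < 1 := by rw [hs]; exact Real.rpow_lt_one_of_one_lt_of_neg hQ1 (by linarith)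
  have hp0 : 0 < p := by rw [hp]; positivity
  have hp1 : p < 1 := by rw [hp]; exact inv_lt_one_of_one_lt₀ hQ1
  have hkey := fracIntConst_mul_kernelFun hβ hs hp n
  set κ := kernelFun α with hκ
  set c := fracIntConst K α with hc
  -- Read off from the case i = 0 of `hkey`, whose right-hand side is nonzero; it allows division by
  -- `c` below.
  have hc0 : c ≠ 0 := by
    intro h0
    have := hkey 0
    rw [h0, zero_mul] at this
    have h1 : 0 < 1 - s := sub_pos.2 hs1
    have h2 : 0 < s * (1 - s) * s ^ (-n) := by positivity
    simp only [convCoeff] at this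
    linarith
  have hcC : (c : ℂ) ≠ 0 := Complex.ofReal_ne_zero.2 hc0
  have hkeyC : ∀ i : ℕ, (c : ℂ) * ((residueCard K : ℂ) ^ (n - 1 - i : ℤ) *
      ((κ ((residueCard K : ℝ) ^ n) : ℂ) - κ ((residueCard K : ℝ) ^ (n - 1 - i : ℤ))))
      = -(s * (1 - s) * (s : ℂ) ^ (-n) * convCoeff s p i) := fun i => by
    have := congrArg Complex.ofReal (hkey i)
    push_cast at this
    exact this
  set w := radialSeq β v with hw
  set b : ℂ := s * (1 - s) * (s : ℂ) ^ (-n) with hbdef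
  have hk := summable_convCoeff hs0 hs1 hp0 hp1
  have hkC : Summable fun i => (convCoeff s p i : ℂ) := Complex.ofRealCLM.summable hk
  obtain ⟨B, hB⟩ := hb (n - 1)
  have hkw := summable_norm_causal hk (convCoeff_nonneg hs0 hp0) hB
  -- the part over `|y| < |x|`
  set g : K → ℂ := fun y => ((κ ‖x‖ : ℂ) - κ ‖y‖) * v y with hg
  set h : K → ℂ := fun z => ((κ ‖z‖ : ℂ) - κ ‖x‖) * v x with hh
  have hgr : IsRadial g := fun y z hyz => by simp only [hg]; rw [hyz, hv y z hyz]
  have hhr : IsRadial h := fun y z hyz => by simp only [hh]; rw [hyz]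
  have hgT : ∀ i : ℕ, (residueCard K : ℂ) ^ (n - 1 - i : ℤ) * g (β ^ (-(n - 1 - i : ℤ)))
      = -(b / c) * ((convCoeff s p i : ℂ) * w (n - 1 - i)) := fun i => by
    have hi := hkeyC i
    simp only [hg, hβ.norm_zpow_neg, hx]
    rw [show v (β ^ (-(n - 1 - i : ℤ))) = w (n - 1 - i) from rfl]
    field_simp
    linear_combination w (n - 1 - i) * hi
  have hhT : ∀ i : ℕ, (residueCard K : ℂ) ^ (n - 1 - i : ℤ) * h (β ^ (-(n - 1 - i : ℤ)))
      = (b / c * v x) * (convCoeff s p i : ℂ) := fun i => by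
    have hi := hkeyC i
    simp only [hh, hβ.norm_zpow_neg, hx]
    field_simp
    linear_combination (-v x) * hi
  obtain ⟨ig, eg⟩ := hgr.integral_norm_lt hβ hμ hgT
    ((hkw.mul_left ‖-(b / c)‖).congr fun i => (norm_mul _ _).symm)
  obtain ⟨ih, eh⟩ := hhr.integral_norm_lt hβ hμ hhT
    ((hkC.norm.mul_left ‖b / c * v x‖).congr fun i => (norm_mul _ _).symm)
  rw [tsum_mul_left] at eg eh
  rw [← hx] at ig eg ih eh
  have hmeas : MeasurableSet {y : K | ‖y‖ ≤ ‖x‖} :=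
    measurableSet_le continuous_norm.measurable measurable_const
  obtain ⟨iF, eF⟩ := integral_indicator_add_reflect (μ := μ) (measurableSet_norm_lt ‖x‖)
    (measurableSet_norm_lt ‖x‖) ig ih
    (F := {y : K | ‖y‖ ≤ ‖x‖}.indicator fun y => (fracIntKernel α x y : ℂ) * v y) (x := x) (by
      intro y
      simp only [Set.indicator_apply, Set.mem_ofPred_eq, fracIntKernel_eq, hg, hh]
      rcases lt_trichotomy ‖y‖ ‖x‖ with hy | hy | hy
      · have h1 := norm_sub_eq_of_lt hy
        rw [if_pos hy.le, if_pos hy, if_neg (by rw [h1]; exact lt_irrefl _), h1]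
        push_cast; ring
      · have h2 : ‖x - y‖ ≤ ‖x‖ := by
          have := IsUltrametricDist.norm_add_le_max x (-y)
          rwa [norm_neg, hy, max_self, ← sub_eq_add_neg] at this
        rw [if_pos hy.le, if_neg hy.not_lt, hy, hv y x hy]
        split_ifs with h3
        · push_cast; ring
        · rw [le_antisymm h2 (not_lt.1 h3)]; simp
      · have h1 := norm_sub_eq_of_lt hy
        rw [norm_sub_rev] at h1
        rw [if_neg (not_le.2 hy), if_neg (not_lt.2 hy.le), if_neg (by rw [h1]; exact not_lt.2 hy.le),
          add_zero])
  refine ⟨(integrable_indicator_iff hmeas).1 iF, ?_⟩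
  rw [integral_indicator hmeas] at eF
  have hts := tsum_convCoeff hs0 hs1 hp0 hp1
  have hpC : (residueCard K : ℂ)⁻¹ = p := by rw [hp]; push_cast; rfl
  rw [fracInt, eF, eg, eh, hpC, fracSeq, ← hc, hv.eq_radialSeq hβ hx, ← hw]
  change _ = (s : ℂ) ^ (-n) * (s * (w n - (1 - s) * (1 - p) *
    ∑' i : ℕ, (convCoeff s p i : ℂ) * w (n - 1 - i)))
  set S := ∑' i : ℕ, (convCoeff s p i : ℂ) * w (n - 1 - i)
  set H := ∑' i : ℕ, (convCoeff s p i : ℂ)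
  field_simp
  rw [hbdef]
  linear_combination (s : ℂ) ^ (-n) * s * w n * hts

end FractionalIntegral

/-! ### The hypersingular integral inverts the fractional integral. -/

section FractionalDerivative

variable {K : Type*} [NontriviallyNormedField K] [IsUltrametricDist K] {β : K}
  [MeasurableSpace K] [BorelSpace K] {μ : Measure K} [LocallyCompactSpace K]

/-- The fractional derivative inverts the fractional integral, along the value group. -/
lemma hypersingularIntegral_eq [μ.IsAddHaarMeasure] (hβ : IsNormalizedUniformizer β)
    (hμ : μ (Metric.closedBall (0 : K) 1) = 1) {α : ℝ} (hα : 0 < α) {s p : ℝ}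
    (hs : s = (residueCard K : ℝ) ^ (-α)) (hp : p = (residueCard K : ℝ)⁻¹) {u : K → ℂ} {w : ℤ → ℂ}
    (hu : IsRadial u) (hw : BddLeft w)
    (huw : ∀ n, radialSeq β u n = (s : ℂ) ^ (-n) * fracSeq s p w n) {N : ℤ}
    (hR : Summable fun j : ℕ => ‖causalSum s p w (N + j)‖) {x : K} {n : ℤ}
    (hx : ‖x‖ = (residueCard K : ℝ) ^ n) :
    Integrable (hypersingularIntegrand α u x) μ ∧ hypersingularIntegral μ α u x = w n := by
  have hQ := hβ.cast_pos
  have hQ1 := hβ.one_lt_cast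
  have hs0 : 0 < s := by rw [hs]; positivity
  have hs1 : s < 1 := by rw [hs]; exact Real.rpow_lt_one_of_one_lt_of_neg hQ1 (by linarith)
  have hp0 : 0 < p := by rw [hp]; positivity
  have hp1 : p < 1 := by rw [hp]; exact inv_lt_one_of_one_lt₀ hQ1
  have hsC : (s : ℂ) ≠ 0 := Complex.ofReal_ne_zero.2 hs0.ne'
  have hpC : (p : ℂ) ≠ 0 := Complex.ofReal_ne_zero.2 hp0.ne'
  have hQC : (residueCard K : ℂ) = (p : ℂ)⁻¹ := by rw [hp]; push_cast; rw [inv_inv]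
  have hQs : (residueCard K : ℝ) ^ α = s⁻¹ := by rw [hs, Real.rpow_neg hQ.le, inv_inv]
  have hQsp : (residueCard K : ℝ) ^ (-α - 1) = s * p := by
    rw [hs, hp, Real.rpow_sub hQ, Real.rpow_one, div_eq_mul_inv]
  have hnorm : ∀ m : ℤ, ((((residueCard K : ℝ) ^ m) ^ (-α - 1) : ℝ) : ℂ)
      = (s : ℂ) ^ m * (p : ℂ) ^ m := fun m => by
    rw [zpow_rpow_comm hQ, hQsp, mul_zpow]; push_cast; rfl
  have hun : ∀ m : ℤ, u (β ^ (-m)) = (s : ℂ) ^ (-m) * fracSeq s p w m := huw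
  have hux : u x = (s : ℂ) ^ (-n) * fracSeq s p w n := by rw [hu.eq_radialSeq hβ hx, huw]
  set U := fracSeq s p w with hU
  set g : K → ℂ := fun y => ((‖y‖ ^ (-α - 1) : ℝ) : ℂ) * (u y - u x) with hg
  set h : K → ℂ := fun z => ((‖x‖ ^ (-α - 1) : ℝ) : ℂ) * (u z - u x) with hh
  have hgr : IsRadial g := fun y z hyz => by simp only [hg]; rw [hyz, hu y z hyz]
  have hhr : IsRadial h := fun y z hyz => by simp only [hh]; rw [hu y z hyz]
  -- On |y| = q^m, q^m |y|^(-α-1) = s^m cancels the s^(-m) in u(q^m), leaving U_m without a weight.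
  have hgT : ∀ i : ℕ, (residueCard K : ℂ) ^ (n + 1 + i : ℤ) * g (β ^ (-(n + 1 + i : ℤ)))
      = U (n + 1 + i) - (s : ℂ) ^ (i + 1) * U n := fun i => by
    simp only [hg, hβ.norm_zpow_neg, hnorm, hun, hux, hQC]
    have e : (s : ℂ) ^ (n + 1 + i : ℤ) = (s : ℂ) ^ n * (s : ℂ) ^ (i + 1) := by
      rw [← zpow_natCast, ← zpow_add₀ hsC]; congr 1; push_cast; ring
    have hpn : (p : ℂ) ^ (n + 1 + i : ℤ) ≠ 0 := zpow_ne_zero _ hpC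
    have hsn : (s : ℂ) ^ n ≠ 0 := zpow_ne_zero _ hsC
    rw [inv_zpow, zpow_neg, zpow_neg, e]
    field_simp
  have hhT : ∀ i : ℕ, (residueCard K : ℂ) ^ (n - 1 - i : ℤ) * h (β ^ (-(n - 1 - i : ℤ)))
      = (((s * p) ^ (i + 1) : ℝ) : ℂ) * U (n - 1 - i) - (p : ℂ) ^ (i + 1) * U n := fun i => by
    simp only [hh, hx, hnorm, hun, hux, hQC]
    have e : ∀ r : ℂ, r ≠ 0 → r ^ (n : ℤ) = r ^ (n - 1 - i : ℤ) * r ^ (i + 1) := fun r hr => by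
      rw [← zpow_natCast, ← zpow_add₀ hr]; congr 1; push_cast; ring
    have hpn : (p : ℂ) ^ (n - 1 - i : ℤ) ≠ 0 := zpow_ne_zero _ hpC
    have hsn : (s : ℂ) ^ (n - 1 - i : ℤ) ≠ 0 := zpow_ne_zero _ hsC
    rw [inv_zpow, zpow_neg, zpow_neg, e s hsC, e p hpC]
    push_cast
    field_simp
    ring
  have hgeo : ∀ r : ℝ, 0 < r → r < 1 → Summable (fun i : ℕ => ‖(r : ℂ) ^ (i + 1) * U n‖) ∧
      HasSum (fun i : ℕ => (r : ℂ) ^ (i + 1) * U n) (r / (1 - r) * U n) := fun r hr hr1 => by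
    have hn : ‖(r : ℂ)‖ < 1 := by rwa [Complex.norm_real, Real.norm_of_nonneg hr.le]
    have h1 := ((hasSum_geometric_of_norm_lt_one hn).mul_left (r : ℂ)).mul_right (U n)
    refine ⟨?_, ?_⟩
    · have := ((summable_geometric_of_lt_one (norm_nonneg _) hn).mul_left ‖(r : ℂ)‖).mul_right ‖U n‖
      exact this.congr fun i => by rw [norm_mul, norm_pow, pow_succ']
    · rw [div_eq_mul_inv]
      exact h1.congr_fun fun i => by ring
  have hsumU := summable_fracSeq hs0 hs1 hp0 hp1 hw hR (n + 1)
  have hsp0 : 0 < s * p := by positivity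
  have hsp1 : s * p < 1 := mul_lt_one_of_nonneg_of_lt_one_left hs0.le hs1 hp1.le
  have hsumE : Summable fun i : ℕ => ‖(((s * p) ^ (i + 1) : ℝ) : ℂ) * U (n - 1 - i)‖ := by
    obtain ⟨B, hB⟩ := bddLeft_fracSeq hs0 hs1 hp0 hp1 hw (n - 1)
    exact summable_norm_causal
      ((summable_nat_add_iff 1).2 (summable_geometric_of_lt_one hsp0.le hsp1))
      (fun i => by positivity) hB
  obtain ⟨ig, eg⟩ := hgr.integral_norm_gt hβ hμ hgT
    (Summable.of_nonneg_of_le (fun _ => norm_nonneg _) (fun i => norm_sub_le _ _)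
      (hsumU.add (hgeo s hs0 hs1).1))
  obtain ⟨ih, eh⟩ := hhr.integral_norm_lt hβ hμ hhT
    (Summable.of_nonneg_of_le (fun _ => norm_nonneg _) (fun i => norm_sub_le _ _)
      (hsumE.add (hgeo p hp0 hp1).1))
  rw [((hasSum_fracSeq_right hs0 hs1 hp0 hp1 hw hR n).sub (hgeo s hs0 hs1).2).tsum_eq] at eg
  rw [((hasSum_fracSeq_left hs0 hs1 hp0 hp1 hw n).sub (hgeo p hp0 hp1).2).tsum_eq] at eh
  rw [← hx] at ig eg ih eh
  -- The integrand vanishes for |y| < |x|. For |y| > |x|, |x - y| = |y| gives `g`. On |y| = |x| only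
  -- |x - y| < |x| contributes, which is `h` after reflection.
  obtain ⟨iF, eF⟩ := integral_indicator_add_reflect (μ := μ)
    (measurableSet_lt measurable_const continuous_norm.measurable)
    (measurableSet_norm_lt ‖x‖) ig ih (F := hypersingularIntegrand α u x) (x := x) (by
      intro y
      simp only [hypersingularIntegrand, Set.indicator_apply, Set.mem_ofPred_eq, hg, hh]
      rcases lt_trichotomy ‖y‖ ‖x‖ with hy | hy | hy
      · have h1 := norm_sub_eq_of_lt hy
        rw [if_neg (not_lt.2 hy.le), if_neg h1.not_lt, hu _ _ h1]
        simp
      · have h2 : ‖x - y‖ ≤ ‖x‖ := by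
          have := IsUltrametricDist.norm_add_le_max x (-y)
          rwa [norm_neg, hy, max_self, ← sub_eq_add_neg] at this
        rw [if_neg (by rw [hy]; exact lt_irrefl _), hy]
        split_ifs with h3
        · simp
        · rw [hu _ _ (le_antisymm h2 (not_lt.1 h3))]; simp
      · have h1 := norm_sub_eq_of_lt hy
        rw [norm_sub_rev] at h1
        rw [if_pos hy, if_neg (by rw [h1]; exact not_lt.2 hy.le), hu _ _ h1, add_zero])
  refine ⟨iF, ?_⟩
  have hpQ : (residueCard K : ℂ)⁻¹ = p := by rw [hQC, inv_inv]
  have hs1C : (1 - s : ℂ) ≠ 0 := by exact_mod_cast (sub_pos.2 hs1).ne'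
  have hp1C : (1 - p : ℂ) ≠ 0 := by exact_mod_cast (sub_pos.2 hp1).ne'
  have hspC : (1 - s * p : ℂ) ≠ 0 := by exact_mod_cast (sub_pos.2 hsp1).ne'
  rw [hypersingularIntegral, eF, eg, eh, hpQ, hQs, hQsp, hU, fracSeq_eq_sub hs0 hs1 hp0 hp1 hw n,
    causalSum_recurrence hs0 hs1 hp0 hp1 hw n]
  push_cast
  field_simp
  ring

end FractionalDerivative

/-! ### Radial functions versus sequences. -/

section Radial

lemma tendsto_zpow_zero_of_lt_one {r : ℝ} (hr0 : 0 < r) (hr1 : r < 1) :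
    Tendsto (fun n : ℤ => r ^ n) atTop (𝓝 0) := by
  refine tendsto_order.2 ⟨fun c hc => Eventually.of_forall fun n => hc.trans (by positivity),
    fun c hc => ?_⟩
  obtain ⟨k, hk⟩ := exists_pow_lt_of_lt_one hc hr1
  filter_upwards [eventually_ge_atTop (k : ℤ)] with n hn
  exact (zpow_le_zpow_right_of_le_one₀ hr0 hr1.le hn).trans_lt (by rwa [zpow_natCast])

lemma tendsto_zpow_neg_atBot_zero {r : ℝ} (hr0 : 0 < r) (hr1 : r < 1) :
    Tendsto (fun n : ℤ => r ^ (-n)) atBot (𝓝 0) :=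
  (tendsto_zpow_zero_of_lt_one hr0 hr1).comp tendsto_neg_atBot_atTop

variable {K : Type*} [NontriviallyNormedField K] [IsUltrametricDist K] {β : K}

lemma tendsto_radialSeq (hβ : IsNormalizedUniformizer β) {v : K → ℂ} (hc : Continuous v) :
    Tendsto (radialSeq β v) atBot (𝓝 (v 0)) := by
  refine (hc.tendsto 0).comp (tendsto_zero_iff_norm_tendsto_zero.2 ?_)
  refine (tendsto_zpow_neg_atBot_zero (inv_pos.2 hβ.cast_pos)
    (inv_lt_one_of_one_lt₀ hβ.one_lt_cast)).congr fun n => ?_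
  rw [hβ.norm_zpow_neg, inv_zpow, zpow_neg, inv_inv]

/-- Away from 0 a radial function is locally constant, by the ultrametric inequality, so only the
origin imposes a condition. -/
lemma IsRadial.continuous_of_tendsto (hβ : IsNormalizedUniformizer β) {v : K → ℂ}
    (hv : IsRadial v) (h : Tendsto (radialSeq β v) atBot (𝓝 (v 0))) : Continuous v := by
  refine continuous_iff_continuousAt.2 fun x => ?_
  rcases eq_or_ne x 0 with rfl | hx
  · intro U hU
    obtain ⟨N, hN⟩ := eventually_atBot.1 (h hU)
    refine Metric.mem_nhds_iff.2 ⟨_, zpow_pos hβ.cast_pos (N + 1), fun x hx => ?_⟩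
    rcases eq_or_ne x 0 with rfl | hx0
    · exact mem_of_mem_nhds (x := v 0) hU
    · obtain ⟨m, hm⟩ := hβ.exists_norm_eq hx0
      rw [mem_ball_zero_iff, hm, zpow_lt_zpow_iff_right₀ hβ.one_lt_cast] at hx
      change v x ∈ U
      rw [hv.eq_radialSeq hβ hm]
      exact hN m (by omega)
  · refine (continuousAt_const (y := v x)).congr ?_
    filter_upwards [Metric.ball_mem_nhds x (norm_pos_iff.2 hx)] with y hy
    refine hv _ _ ?_
    rw [mem_ball_iff_norm'] at hy
    have := norm_sub_eq_of_lt hy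
    rwa [sub_sub_cancel, eq_comm] at this

lemma IsRadial.ext (hβ : IsNormalizedUniformizer β) {v w : K → ℂ} (hv : IsRadial v)
    (hw : IsRadial w) (h0 : v 0 = w 0) (h : ∀ n, radialSeq β v n = radialSeq β w n) : v = w := by
  funext x
  rcases eq_or_ne x 0 with rfl | hx
  · exact h0
  · obtain ⟨n, hn⟩ := hβ.exists_norm_eq hx
    rw [hv.eq_radialSeq hβ hn, hw.eq_radialSeq hβ hn, h]

lemma exists_radial (hβ : IsNormalizedUniformizer β) (w : ℤ → ℂ) (c : ℂ) :
    ∃ v : K → ℂ, IsRadial v ∧ v 0 = c ∧ radialSeq β v = w := by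
  refine ⟨fun x => if ‖x‖ = 0 then c else w (Int.log (residueCard K) ‖x‖),
    fun x y h => by simp only [h], by simp, funext fun n => ?_⟩
  simp only [radialSeq, hβ.norm_zpow_neg]
  rw [if_neg (zpow_pos hβ.cast_pos n).ne', Int.log_zpow hβ.one_lt_residueCard]

end Radial

/-! ### From sequences back to the integral equation and the Cauchy problem. -/

section SolutionTheory

/-- R is bounded on both sides, hence so is w by the recurrence. This brings continuous solutions
within reach of uniqueness among bounded sequences. -/
lemma exists_bound_of_summable {s p : ℝ} (hs : 0 < s) (hs1 : s < 1) (hp : 0 < p) (hp1 : p < 1)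
    {w : ℤ → ℂ} (hw : BddLeft w) {N : ℤ}
    (hR : Summable fun j : ℕ => ‖causalSum s p w (N + j)‖) : ∃ B, ∀ n, ‖w n‖ ≤ B := by
  obtain ⟨T, hT⟩ : ∃ T, ∀ n, ‖causalSum s p w n‖ ≤ T := by
    obtain ⟨T₁, hT₁⟩ := bddLeft_causalSum hs hs1 hp hp1 hw N
    refine ⟨max T₁ (∑' j : ℕ, ‖causalSum s p w (N + j)‖), fun n => ?_⟩
    rcases le_total n N with h | h
    · exact (hT₁ n h).trans (le_max_left _ _)
    · obtain ⟨k, rfl⟩ := Int.le.dest h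
      exact (hR.le_tsum k fun _ _ => norm_nonneg _).trans (le_max_right _ _)
  refine ⟨T + ‖(s + p : ℂ)‖ * T + ‖(s * p : ℂ)‖ * T, fun n => ?_⟩
  rw [causalSum_recurrence hs hs1 hp hp1 hw n]
  refine (norm_add_le _ _).trans (add_le_add ((norm_sub_le _ _).trans (add_le_add (hT _) ?_)) ?_)
  · rw [norm_mul]; gcongr; exact hT _
  · rw [norm_mul]; gcongr; exact hT _

variable {K : Type*} [NontriviallyNormedField K] [IsUltrametricDist K] {β : K}
  [MeasurableSpace K] [BorelSpace K] {μ : Measure K} [LocallyCompactSpace K]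

lemma fracInt_zero {K : Type*} [NontriviallyNormedField K] [IsUltrametricDist K]
    [MeasurableSpace K] [BorelSpace K] {μ : Measure K} [LocallyCompactSpace K] [μ.IsAddHaarMeasure] (α : ℝ) (v : K → ℂ) :
    FracIntExistsAt μ α v 0 ∧ fracInt μ α v 0 = 0 := by
  have h : μ {y : K | ‖y‖ ≤ ‖(0 : K)‖} = 0 := by
    convert measure_singleton (μ := μ) (0 : K)
    ext y
    simp
  refine ⟨IntegrableOn.of_measure_zero h, ?_⟩
  rw [fracInt, setIntegral_measure_zero _ h, mul_zero]

/-- The integral equation amounts to a recurrence along the value group. -/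
lemma isIntegralEqSolution_iff [μ.IsAddHaarMeasure] (hβ : IsNormalizedUniformizer β)
    (hμ : μ (Metric.closedBall (0 : K) 1) = 1) {α : ℝ} (hα : 0 < α) {s p : ℝ}
    (hs : s = (residueCard K : ℝ) ^ (-α)) (hp : p = (residueCard K : ℝ)⁻¹) {a f v : K → ℂ}
    (ha : IsRadial a) (hf : IsRadial f) (hv : IsRadial v) (hvc : Continuous v) :
    IsIntegralEqSolution μ α a f v ↔ v 0 = f 0 ∧ ∀ n, radialSeq β v n + radialSeq β a n *
      ((s : ℂ) ^ (-n) * fracSeq s p (radialSeq β v) n) = radialSeq β f n := by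
  have hb := bddLeft_of_tendsto (tendsto_radialSeq hβ hvc)
  have hI := fun (x : K) (n : ℤ) (hx : ‖x‖ = (residueCard K : ℝ) ^ n) =>
    fracInt_eq hβ hμ hα hs hp hv hb hx
  have h0 := fracInt_zero (μ := μ) α v
  constructor
  · refine fun h => ⟨by simpa [h0.2] using h.equation 0, fun n => ?_⟩
    rw [← (hI _ n (hβ.norm_zpow_neg n)).2]
    exact h.equation _
  · refine fun h => ⟨hv, hvc, fun x => ?_, fun x => ?_⟩
    · rcases eq_or_ne x 0 with rfl | hx
      · exact h0.1
      · obtain ⟨n, hn⟩ := hβ.exists_norm_eq hx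
        exact (hI x n hn).1
    · rcases eq_or_ne x 0 with rfl | hx
      · rw [h0.2, mul_zero, add_zero, h.1]
      · obtain ⟨n, hn⟩ := hβ.exists_norm_eq hx
        rw [(hI x n hn).2, hv.eq_radialSeq hβ hn, ha.eq_radialSeq hβ hn, hf.eq_radialSeq hβ hn,
          h.2 n]

/-- The equivalence of `ℕ` with a right half-line of `ℤ`. -/
def natEquivIci (m : ℤ) : ℕ ≃ Set.Ici m where
  toFun j := ⟨m + j, by simp⟩
  invFun l := ((l : ℤ) - m).toNat
  left_inv j := by simp
  right_inv l := Subtype.ext (by have : m ≤ (l : ℤ) := l.2; simp only; omega)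

/-- The equivalence of `ℕ` with a left half-line of `ℤ`. -/
def natEquivIic (m : ℤ) : ℕ ≃ Set.Iic m where
  toFun j := ⟨m - j, by simp⟩
  invFun l := (m - (l : ℤ)).toNat
  left_inv j := by simp
  right_inv l := Subtype.ext (by have : (l : ℤ) ≤ m := l.2; simp only; omega)

/-- The fractional integral of `v` has the strong fractional derivative `v`. -/
lemma hasStrongFracDeriv_fracInt [μ.IsAddHaarMeasure] (hβ : IsNormalizedUniformizer β)
    (hμ : μ (Metric.closedBall (0 : K) 1) = 1) {α : ℝ} (hα : 0 < α) {s p : ℝ}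
    (hs : s = (residueCard K : ℝ) ^ (-α)) (hp : p = (residueCard K : ℝ)⁻¹) {v : K → ℂ}
    (hv : IsRadial v) (hvc : Continuous v) {N : ℤ}
    (hR : Summable fun j : ℕ => ‖causalSum s p (radialSeq β v) (N + j)‖) :
    HasStrongFracDeriv μ β α (fracInt μ α v) v ∧ Continuous (fracInt μ α v) := by
  have hQ := hβ.cast_pos
  have hQ1 := hβ.one_lt_cast
  have hs0 : 0 < s := by rw [hs]; positivity
  have hs1 : s < 1 := by rw [hs]; exact Real.rpow_lt_one_of_one_lt_of_neg hQ1 (by linarith)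
  have hp0 : 0 < p := by rw [hp]; positivity
  have hp1 : p < 1 := by rw [hp]; exact inv_lt_one_of_one_lt₀ hQ1
  have hb := bddLeft_of_tendsto (tendsto_radialSeq hβ hvc)
  have hI := fun (x : K) (n : ℤ) (hx : ‖x‖ = (residueCard K : ℝ) ^ n) =>
    (fracInt_eq hβ hμ hα hs hp hv hb hx).2
  have h0 := (fracInt_zero (μ := μ) α v).2
  set u := fracInt μ α v with hu
  have hru : IsRadial u := fun x y hxy => by
    rcases eq_or_ne x 0 with rfl | hx
    · rw [norm_zero, eq_comm, norm_eq_zero] at hxy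
      rw [hxy]
    · obtain ⟨n, hn⟩ := hβ.exists_norm_eq hx
      rw [hI x n hn, hI y n (hxy ▸ hn)]
  have huw : ∀ n, radialSeq β u n = (s : ℂ) ^ (-n) * fracSeq s p (radialSeq β v) n := fun n =>
    hI _ n (hβ.norm_zpow_neg n)
  have hnu : ∀ n, ‖u (β ^ (-n))‖ = s ^ (-n) * ‖fracSeq s p (radialSeq β v) n‖ := fun n => by
    have := congrArg norm (huw n)
    rwa [norm_mul, norm_zpow, Complex.norm_real, Real.norm_of_nonneg hs0.le] at this
  obtain ⟨B, hB⟩ := bddLeft_fracSeq hs0 hs1 hp0 hp1 hb 0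
  have huc : Continuous u := by
    refine hru.continuous_of_tendsto hβ ?_
    rw [h0]
    refine squeeze_zero_norm' ?_
      (((tendsto_zpow_neg_atBot_zero hs0 hs1).mul_const B).trans_eq (by rw [zero_mul]))
    filter_upwards [eventually_le_atBot 0] with n hn
    change ‖u (β ^ (-n))‖ ≤ _
    rw [hnu]
    gcongr
    exact hB n hn
  have hDx := fun (x : K) (n : ℤ) (hx : ‖x‖ = (residueCard K : ℝ) ^ n) =>
    hypersingularIntegral_eq hβ hμ hα hs hp hru hb huw hR hx
  refine ⟨⟨hru, ⟨0, ?_, ?_⟩, fun x hx => ?_, fun x hx => ?_, ?_⟩, huc⟩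
  · rw [← (natEquivIic 0).summable_iff]
    obtain ⟨B', hB'⟩ := bddLeft_of_tendsto (tendsto_radialSeq hβ huc) 0
    refine Summable.of_nonneg_of_le (fun j => by simp only [Function.comp]; positivity)
      (fun j => ?_) ((summable_geometric_of_lt_one hp0.le hp1).mul_right B')
    simp only [Function.comp, natEquivIic, Equiv.coe_fn_mk]
    have e : (residueCard K : ℝ) ^ (0 - (j : ℤ)) = p ^ j := by
      rw [zero_sub, zpow_neg, zpow_natCast, hp, inv_pow]
    rw [e]
    gcongr
    exact hB' _ (by omega)
  -- The weight q^(-αl) = s^l cancels s^(-l) in u(q^l), so this is the series of |U_l|.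
  · rw [← (natEquivIci 0).summable_iff]
    refine (summable_fracSeq hs0 hs1 hp0 hp1 hb hR 0).congr fun j => ?_
    simp only [Function.comp, natEquivIci, Equiv.coe_fn_mk]
    rw [hnu, Real.rpow_mul hQ.le, Real.rpow_intCast, ← hs, ← mul_assoc, ← zpow_add₀ hs0.ne',
      add_neg_cancel, zpow_zero, one_mul]
  · obtain ⟨n, hn⟩ := hβ.exists_norm_eq hx
    exact (hDx x n hn).1
  · obtain ⟨n, hn⟩ := hβ.exists_norm_eq hx
    rw [(hDx x n hn).2, hv.eq_radialSeq hβ hn]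
  -- The derivative is v itself, so its limit at 0 is the continuity of v.
  · exact (hvc.tendsto 0).mono_left nhdsWithin_le_nhds

end SolutionTheory
end RadialFrac

/-! ### The main theorem. -/

theorem theorem2 {K : Type*} [NontriviallyNormedField K] [IsUltrametricDist K]
    [LocallyCompactSpace K] [MeasurableSpace K] [BorelSpace K]
    (β : K) (hβ : RadialFrac.IsNormalizedUniformizer β)
    (μ : Measure K) [μ.IsAddHaarMeasure] (hμ : μ (Metric.closedBall (0 : K) 1) = 1)
    (α : ℝ) (hα : 0 < α)
    (a f : K → ℂ)
    (ha_rad : RadialFrac.IsRadial a) (ha_cont : Continuous a)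
    (hf_rad : RadialFrac.IsRadial f) (hf_cont : Continuous f)
    (ha_ne : ∀ (x : K) (m : ℤ),
      a x ≠ -(((RadialFrac.residueCard K : ℝ) ^ (α * (m : ℝ)) : ℝ) : ℂ))
    (C ε : ℝ) (hC : 0 < C) (hε : 0 < ε)
    (ha_decay : ∀ x : K, 1 < ‖x‖ → ‖a x‖ ≤ C * ‖x‖ ^ (-α - ε))
    (hf_decay : ∀ x : K, 1 < ‖x‖ → ‖f x‖ ≤ C * ‖x‖ ^ (-ε)) :
    (∃! v : K → ℂ, RadialFrac.IsIntegralEqSolution μ α a f v) ∧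
      ∀ v : K → ℂ, RadialFrac.IsIntegralEqSolution μ α a f v →
        RadialFrac.IsStrongRadialSolution μ β α a f (RadialFrac.fracInt μ α v) := by
  open RadialFrac in
  have hQ := hβ.cast_pos
  have hQ1 := hβ.one_lt_cast
  obtain ⟨s, hs⟩ : ∃ s : ℝ, s = (residueCard K : ℝ) ^ (-α) := ⟨_, rfl⟩
  obtain ⟨p, hp⟩ : ∃ p : ℝ, p = (residueCard K : ℝ)⁻¹ := ⟨_, rfl⟩
  obtain ⟨τ, hτ⟩ : ∃ τ : ℝ, τ = (residueCard K : ℝ) ^ (-ε) := ⟨_, rfl⟩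
  have hs0 : 0 < s := by rw [hs]; positivity
  have hs1 : s < 1 := by rw [hs]; exact Real.rpow_lt_one_of_one_lt_of_neg hQ1 (by linarith)
  have hp0 : 0 < p := by rw [hp]; positivity
  have hp1 : p < 1 := by rw [hp]; exact inv_lt_one_of_one_lt₀ hQ1
  have hτ0 : 0 < τ := by rw [hτ]; positivity
  have hτ1 : τ < 1 := by rw [hτ]; exact Real.rpow_lt_one_of_one_lt_of_neg hQ1 (by linarith)
  have hsC : (s : ℂ) ≠ 0 := Complex.ofReal_ne_zero.2 hs0.ne'
  -- the coefficients of the recurrence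
  set b : ℤ → ℂ := fun n => radialSeq β a n * ((s : ℂ) ^ (-n) * s) with hb
  set c : ℤ → ℂ := fun n => b n * ((1 - s) * (1 - p)) / (1 + b n) with hc
  set d : ℤ → ℂ := fun n => radialSeq β f n / (1 + b n) with hd
  -- Vanishing would mean a(q^n) = -s^(n-1) = -q^(α(1-n)), an excluded value; hence the exponent 1 -
  -- n.
  have hb1 : ∀ n, 1 + b n ≠ 0 := fun n h => by
    refine ha_ne (β ^ (-n)) (1 - n) ?_
    have e : ((residueCard K : ℝ) ^ (α * ((1 - n : ℤ) : ℝ))) = (s ^ (-n) * s)⁻¹ := by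
      rw [Real.rpow_mul hQ.le, Real.rpow_intCast, ← zpow_add_one₀ hs0.ne', ← zpow_neg, hs,
        Real.rpow_neg hQ.le, inv_zpow', neg_neg, neg_add_eq_sub]
    rw [e]
    push_cast
    have hne : ((s : ℂ) ^ (-n) * s) ≠ 0 := mul_ne_zero (zpow_ne_zero _ hsC) hsC
    change radialSeq β a n = _
    field_simp
    simp only [hb] at h
    linear_combination h
  have hnorm_one : ∀ n : ℤ, 1 ≤ n → 1 < ‖β ^ (-n)‖ := fun n hn => by
    rw [hβ.norm_zpow_neg]; exact one_lt_zpow₀ hQ1 (by omega)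
  have hb_norm : ∀ n, ‖b n‖ = ‖radialSeq β a n‖ * (s ^ (-n) * s) := fun n => by
    simp only [hb]
    rw [norm_mul, norm_mul, norm_zpow, Complex.norm_real, Real.norm_of_nonneg hs0.le]
  -- At -∞ the factor s^(-n) tends to 0 and a stays bounded; at +∞ that factor blows up and is
  -- offset by a = O(s^n τ^n).
  have hb_bot : Tendsto b atBot (𝓝 0) := by
    have h1 : Tendsto (fun n : ℤ => ‖radialSeq β a n‖ * (s ^ (-n) * s)) atBot
        (𝓝 (‖a 0‖ * (0 * s))) :=
      (tendsto_radialSeq hβ ha_cont).norm.mul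
        ((tendsto_zpow_neg_atBot_zero hs0 hs1).mul_const s)
    rw [zero_mul, mul_zero] at h1
    exact squeeze_zero_norm (fun n => (hb_norm n).le) h1
  have hb_top : Tendsto b atTop (𝓝 0) := by
    refine squeeze_zero_norm' ?_
      (((tendsto_zpow_zero_of_lt_one hτ0 hτ1).const_mul (C * s)).trans_eq (by rw [mul_zero]))
    filter_upwards [eventually_ge_atTop 1] with n hn
    have h1 := ha_decay _ (hnorm_one n hn)
    rw [hβ.norm_zpow_neg, zpow_rpow_comm hQ, sub_eq_add_neg, Real.rpow_add hQ, ← hs, ← hτ,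
      mul_zpow] at h1
    rw [hb_norm]
    calc ‖a (β ^ (-n))‖ * (s ^ (-n) * s) ≤ C * (s ^ n * τ ^ n) * (s ^ (-n) * s) := by gcongr
      _ = C * s * τ ^ n * (s ^ n * s ^ (-n)) := by ring
      _ = C * s * τ ^ n := by rw [← zpow_add₀ hs0.ne', add_neg_cancel, zpow_zero, mul_one]
  have hc_of : ∀ l : Filter ℤ, Tendsto b l (𝓝 0) → Tendsto c l (𝓝 0) := fun l hl => by
    have h1 : Tendsto c l (𝓝 (0 * ((1 - s) * (1 - p)) / (1 + 0))) :=
      (hl.mul_const _).div (hl.const_add 1) (by simp)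
    simpa using h1
  have hc_bot := hc_of _ hb_bot
  have hc_top := hc_of _ hb_top
  have hc_cof : Tendsto c cofinite (𝓝 0) := by
    rw [Int.cofinite_eq]
    exact hc_bot.sup hc_top
  have hd_bot : Tendsto d atBot (𝓝 (f 0)) := by
    have h1 : Tendsto d atBot (𝓝 (f 0 / (1 + 0))) :=
      (tendsto_radialSeq hβ hf_cont).div (hb_bot.const_add 1) (by simp)
    simpa using h1
  -- The factor 2 comes from |1 + b_n| ≥ 1/2 for large n.
  have hd_top : ∀ᶠ n : ℤ in atTop, ‖d n‖ ≤ 2 * C * τ ^ n := by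
    have h2 : ∀ᶠ n : ℤ in atTop, ‖b n‖ ≤ 1 / 2 :=
      hb_top.norm.eventually (eventually_le_nhds (by rw [norm_zero]; norm_num))
    filter_upwards [h2, eventually_ge_atTop 1] with n h2 hn
    have h1 := hf_decay _ (hnorm_one n hn)
    rw [hβ.norm_zpow_neg, zpow_rpow_comm hQ, ← hτ] at h1
    have h3 : 1 / 2 ≤ ‖1 + b n‖ := by
      have := norm_sub_le_norm_add (1 : ℂ) (b n)
      rw [norm_one] at this
      linarith
    simp only [hd]
    rw [norm_div, div_le_iff₀ (by linarith)]
    have h4 : 0 < C * τ ^ n := by positivity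
    change ‖f (β ^ (-n))‖ ≤ _
    nlinarith
  have hd_bdd : ∃ D, ∀ n, ‖d n‖ ≤ D := by
    obtain ⟨N, hN⟩ := eventually_atTop.1 hd_top
    obtain ⟨B, hB⟩ := bddLeft_of_tendsto hd_bot N
    refine ⟨max B (2 * C * τ ^ N), fun n => ?_⟩
    rcases le_total n N with h | h
    · exact (hB n h).trans (le_max_left _ _)
    · refine ((hN n h).trans ?_).trans (le_max_right _ _)
      gcongr 2 * C * ?_
      exact zpow_le_zpow_right_of_le_one₀ hτ0 hτ1.le h
  have hd_nat : ∀ᶠ j : ℕ in atTop, ‖d j‖ ≤ 2 * C * τ ^ j := by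
    filter_upwards [tendsto_natCast_atTop_atTop.eventually hd_top] with j hj
    rwa [zpow_natCast] at hj
  -- the equation as a recurrence
  have hrec : ∀ w : ℤ → ℂ, (∀ n, w n + radialSeq β a n * ((s : ℂ) ^ (-n) * fracSeq s p w n)
      = radialSeq β f n) ↔ ∀ n, w n = d n + c n * causalSum s p w (n - 1) := fun w =>
    forall_congr' fun n => by
      have := hb1 n
      simp only [hd, hc]
      rw [div_mul_eq_mul_div, ← add_div, eq_div_iff this, fracSeq]
      simp only [hb]
      constructor <;> intro h <;> linear_combination h
  have hsol := fun (v : K → ℂ) (hv : IsRadial v) (hvc : Continuous v) =>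
    isIntegralEqSolution_iff (μ := μ) hβ hμ hα hs hp ha_rad hf_rad hv hvc
  have hsum : ∀ v, IsIntegralEqSolution μ α a f v → BddLeft (radialSeq β v) ∧
      (∀ n, radialSeq β v n = d n + c n * causalSum s p (radialSeq β v) (n - 1)) ∧
      ∃ N : ℤ, Summable fun j : ℕ => ‖causalSum s p (radialSeq β v) (N + j)‖ := fun v hv => by
    have h1 := (hrec _).1 ((hsol v hv.radial hv.continuous).1 hv).2
    have h2 := bddLeft_of_tendsto (tendsto_radialSeq hβ hv.continuous)
    exact ⟨h2, h1, summable_causalSum_of_volterra hs0 hs1 hp0 hp1 h2 hc_top (by positivity)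
      hτ0.le hτ1 hd_nat h1⟩
  obtain ⟨w, ⟨⟨B, hwB⟩, hw⟩, hw_unique⟩ :=
    existsUnique_bounded_volterra hs0 hs1 hp0 hp1 hc_cof hd_bdd
  refine ⟨?_, fun v hv => ?_⟩
  · obtain ⟨v, hv, hv0, hvw⟩ := exists_radial hβ w (f 0)
    have hwbl : BddLeft w := fun N => ⟨B, fun n _ => hwB n⟩
    -- The contraction only supplies a bounded sequence; continuity at 0 comes from the equation,
    -- since c_n R_{n-1} → 0 and d_n → f(0).
    have hw_bot : Tendsto w atBot (𝓝 (f 0)) := by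
      have h1 : Tendsto (fun n => c n * causalSum s p w (n - 1)) atBot (𝓝 0) := by
        refine squeeze_zero_norm (fun n => ?_)
          ((hc_bot.norm.mul_const ((∑' i, convCoeff s p i) * B)).trans_eq
            (by rw [norm_zero, zero_mul]))
        rw [norm_mul]
        gcongr
        exact norm_causalSum_le hs0 hs1 hp0 hp1 fun m _ => hwB m
      have h2 := hd_bot.add h1
      rw [add_zero] at h2
      exact h2.congr fun n => (hw n).symm
    have hvc : Continuous v := hv.continuous_of_tendsto hβ (by rw [hvw, hv0]; exact hw_bot)
    refine ⟨v, (hsol v hv hvc).2 ⟨hv0, by rw [hvw]; exact (hrec w).2 hw⟩, fun v' hv' => ?_⟩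
    obtain ⟨h1, h2, N, h3⟩ := hsum v' hv'
    refine hv'.radial.ext hβ hv ?_ fun n => ?_
    · rw [hv0, ((hsol v' hv'.radial hv'.continuous).1 hv').1]
    · rw [hvw, hw_unique _ ⟨exists_bound_of_summable hs0 hs1 hp0 hp1 h1 h3, h2⟩]
  · obtain ⟨h1, h2, N, h3⟩ := hsum v hv
    obtain ⟨h4, h5⟩ := hasStrongFracDeriv_fracInt hβ hμ hα hs hp hv.radial hv.continuous h3
    -- With D^α u = v, the Cauchy equation is literally the integral equation, at 0 as well.
    exact ⟨h4.radial, h5, ⟨v, h4, hv.equation⟩, (fracInt_zero (μ := μ) α v).2⟩
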